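/- Let $n\ge 1$ and let $A\in\mathfrak{sl}(n,\mathbb C)$ be a nonzero nilpotent matrix. With $A^*=\overline A^{\,T}$ and $\|B\|^2=\operatorname{tr}(BB^*)$, put $$K(A)=\frac{\|[A,A^*]\|^2}{\|A\|^4}.$$ For $i\ge 1$ let $J_i$ be the $i\times i$ matrix whose $(p+1,p)$ entry is $\sqrt{p(i-p)}$ for $1\le p\le i-1$ and whose other entries are $0$. For a partition $\lambda=(\lambda_1\ge\dots\ge\lambda_k>0)$ of $n$ put $X^\lambda=\operatorname{diag}(J_{\lambda_1},\dots,J_{\lambda_k})$ and, if $X^\lambda\neq 0$ (that is, $\lambda\ne(1,\dots,1)$), $C_\lambda=K(X^\lambda)$. Partitions of $n$ are ordered by dominance: $\mu\le\lambda$ if $\sum_{i\le p}\mu_i\le\sum_{i\le p}\lambda_i$ for all $p$ (missing parts being $0$). A nilpotent matrix is of Jordan type at most $\lambda$ if the block sizes of its Jordan normal form give a partition $\mu\le\lambda$. (1) If $A$ is of Jordan type at most $\lambda$ (so that $\lambda\neq(1,\dots,1)$), then $$K(A)\ \ge\ C_\lambda=\frac{12}{\sum_{p=1}^k\lambda_p(\lambda_p^2-1)},$$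 and equality $K(A)=C_\lambda$ holds if and only if $A=U(cX^\lambda)U^{-1}$ for some $U\in SU(n)$ and some $c\in\mathbb C\setminus\{0\}$. (2) In every case $$K(A)\ \ge\ C_{(n)}=\frac{12}{n(n^2-1)},$$ and equality holds if and only if $A=U(cJ_n)U^{-1}$ for some $U\in SU(n)$ and some $c\in\mathbb C\setminus\{0\}$. -/

import Mathlib

open scoped Matrix

namespace NilpotentJordan

/-- The parts of a partition of `n`, listed in weakly decreasing order `λ₁ ≥ λ₂ ≥ ⋯ ≥ λ_k > 0`,
as a composition of `n`. -/
def sortedParts {n : ℕ} (lam : n.Partition) : Composition n where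
  blocks := lam.parts.sort (· ≥ ·)
  blocks_pos := fun h => lam.parts_pos ((Multiset.mem_sort (· ≥ ·)).1 h)
  blocks_sum := by
    rw [← Multiset.sum_coe, Multiset.sort_eq, lam.parts_sum]

/-- Dominance order on partitions of `n`: `mu ≤ lam` if
`mu₁ + ⋯ + mu_p ≤ lam₁ + ⋯ + lam_p` for all `p`. -/
def DominatedBy {n : ℕ} (mu lam : n.Partition) : Prop :=
  ∀ p : ℕ, ((sortedParts mu).blocks.take p).sum ≤ ((sortedParts lam).blocks.take p).sum

/-- The `i × i` matrix whose entries on the first subdiagonal are `r 1, …, r (i - 1)`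
(from top to bottom), all other entries being zero. -/
def subdiagonal (i : ℕ) (r : ℕ → ℂ) : Matrix (Fin i) (Fin i) ℂ :=
  Matrix.of fun a b => if (a : ℕ) = (b : ℕ) + 1 then r a else 0

/-- The nilpotent Jordan block of size `i` (ones on the subdiagonal). -/
def nilpotentBlock (i : ℕ) : Matrix (Fin i) (Fin i) ℂ :=
  subdiagonal i fun _ => 1

/-- The normalized Jordan block `J_i`, with subdiagonal entries `r_p = √(p (i - p))`,
`1 ≤ p ≤ i - 1`. -/
noncomputable def elementaryBlock (i : ℕ) : Matrix (Fin i) (Fin i) ℂ :=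
  subdiagonal i fun p => ((Real.sqrt ((p : ℝ) * ((i : ℝ) - (p : ℝ))) : ℝ) : ℂ)

/-- The block diagonal `n × n` matrix `diag (B λ₁, …, B λ_k)`. -/
def blockMatrix {n : ℕ} (B : (i : ℕ) → Matrix (Fin i) (Fin i) ℂ) (lam : n.Partition) :
    Matrix (Fin n) (Fin n) ℂ :=
  Matrix.reindex (sortedParts lam).blocksFinEquiv (sortedParts lam).blocksFinEquiv
    (Matrix.blockDiagonal' fun p : Fin (sortedParts lam).length =>
      B ((sortedParts lam).blocksFun p))

/-- The nilpotent matrix in Jordan normal form with block sizes given by `lam`. -/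
def jordanForm {n : ℕ} (lam : n.Partition) : Matrix (Fin n) (Fin n) ℂ :=
  blockMatrix nilpotentBlock lam

/-- `X^λ = diag (J_{λ₁}, …, J_{λ_k})`. -/
noncomputable def stdNilpotent {n : ℕ} (lam : n.Partition) : Matrix (Fin n) (Fin n) ℂ :=
  blockMatrix elementaryBlock lam

/-- The set of nilpotent matrices in `sl(n, ℂ)`. -/
def nilpotentCone (n : ℕ) : Set (Matrix (Fin n) (Fin n) ℂ) :=
  {A | A ∈ LieAlgebra.SpecialLinear.sl (Fin n) ℂ ∧ IsNilpotent A}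

/-- The block sizes of the Jordan normal form of the nilpotent matrix `A` are given by `mu`. -/
def HasJordanType {n : ℕ} (A : Matrix (Fin n) (Fin n) ℂ) (mu : n.Partition) : Prop :=
  ∃ P : GL (Fin n) ℂ,
    A = (P : Matrix (Fin n) (Fin n) ℂ) * jordanForm mu * ((P⁻¹ : GL (Fin n) ℂ) : Matrix _ _ ℂ)

/-- `A` is of Jordan type at most `lam` for the dominance order. -/
def JordanTypeAtMost {n : ℕ} (A : Matrix (Fin n) (Fin n) ℂ) (lam : n.Partition) : Prop :=
  ∃ mu : n.Partition, HasJordanType A mu ∧ DominatedBy mu lam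

/-- `‖A‖² = tr (A A*)`; this trace is a nonnegative real number. -/
def normSq {n : ℕ} (A : Matrix (Fin n) (Fin n) ℂ) : ℝ :=
  (Matrix.trace (A * Aᴴ)).re

/-- `K(A) = ‖[A, A*]‖² / ‖A‖⁴` (meaningful for `A ≠ 0`). -/
noncomputable def K {n : ℕ} (A : Matrix (Fin n) (Fin n) ℂ) : ℝ :=
  normSq ⁅A, Aᴴ⁆ / normSq A ^ 2

/-- `C_λ = K(X^λ)` (meaningful for `λ ≠ (1, …, 1)`). -/
noncomputable def jordanConst {n : ℕ} (lam : n.Partition) : ℝ :=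
  K (stdNilpotent lam)

/-- `A = U B U⁻¹` for some `U ∈ SU(n)`. -/
def SUConjugate {n : ℕ} (A B : Matrix (Fin n) (Fin n) ℂ) : Prop :=
  ∃ U : Matrix.specialUnitaryGroup (Fin n) ℂ,
    A = (U : Matrix (Fin n) (Fin n) ℂ) * B * (U : Matrix (Fin n) (Fin n) ℂ)ᴴ

end NilpotentJordan

/-! Give the standard basis vectors real weights `w`, and suppose that `B` raises weight by at least
2. Pairing `⁅B, Bᴴ⁆` with the diagonal matrix of `w` gives `∑ (w i - w j) ‖B i j‖²`, which is at
least `2 ‖B‖²`. Cauchy–Schwarz then yields `K B ≥ 4 / ∑ w i²`.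

A Jordan matrix of type `mu` raises the weights of the corresponding sl(2)-representation, for which
`∑ w i²` is one third of the sum of `cubic` over the parts. Listing the weights in decreasing order
and writing the conjugating matrix as unitary times upper triangular (`RaisesWeight.exists_unitary`)
transfers the grading to every matrix of type `mu`, up to a unitary. Convexity of `cubic` makes its
sum strictly increasing for dominance, so the bound for `mu` implies the one for `lam`.

Equality forces `⁅B, Bᴴ⁆` to be a multiple of the weight matrix and `B` to be homogeneous of degree
2. After rescaling, `A` and its adjoint generate a unitary representation of sl(2), which splits
orthogonally into irreducibles, so `A` is unitarily conjugate to some `c • stdNilpotent nu`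
(`RaisesWeight.le_K_and_eq`). Ranks of powers identify `nu` with `mu`. For the universal bound,
unitary triangularization replaces the Jordan form. -/

namespace NilpotentJordan

/-! ### The norm, and invariance of `K` under unitary conjugation and scaling. -/

theorem normSq_eq_sum {n : ℕ} (A : Matrix (Fin n) (Fin n) ℂ) :
    normSq A = ∑ i, ∑ j, ‖A i j‖ ^ 2 := by
  simp only [normSq, Matrix.trace, Matrix.diag_apply, Matrix.mul_apply, Matrix.conjTranspose_apply,
    Complex.re_sum]
  refine Finset.sum_congr rfl fun i _ => Finset.sum_congr rfl fun j _ => ?_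
  rw [Complex.star_def, Complex.mul_conj, Complex.ofReal_re, Complex.normSq_eq_norm_sq]

theorem normSq_nonneg {n : ℕ} (A : Matrix (Fin n) (Fin n) ℂ) : 0 ≤ normSq A := by
  rw [normSq_eq_sum]; positivity

theorem normSq_eq_zero {n : ℕ} {A : Matrix (Fin n) (Fin n) ℂ} : normSq A = 0 ↔ A = 0 := by
  rw [normSq_eq_sum, Finset.sum_eq_zero_iff_of_nonneg (fun _ _ => by positivity)]
  constructor
  · intro h
    ext i j
    have := (Finset.sum_eq_zero_iff_of_nonneg (fun _ _ => by positivity)).1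
      (h i (Finset.mem_univ _)) j (Finset.mem_univ _)
    simpa using this
  · rintro rfl
    simp

theorem normSq_pos {n : ℕ} {A : Matrix (Fin n) (Fin n) ℂ} (hA : A ≠ 0) : 0 < normSq A :=
  lt_of_le_of_ne (normSq_nonneg A) fun h => hA (normSq_eq_zero.1 h.symm)

section conj

variable {n : ℕ} {U : Matrix (Fin n) (Fin n) ℂ}

theorem conj_mul (hU : U ∈ Matrix.unitaryGroup (Fin n) ℂ) (A B : Matrix (Fin n) (Fin n) ℂ) :
    (U * A * Uᴴ) * (U * B * Uᴴ) = U * (A * B) * Uᴴ := by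
  have h : Uᴴ * U = 1 := Matrix.mem_unitaryGroup_iff'.1 hU
  calc (U * A * Uᴴ) * (U * B * Uᴴ) = U * A * (Uᴴ * U) * B * Uᴴ := by simp only [Matrix.mul_assoc]
    _ = _ := by rw [h]; simp only [Matrix.mul_assoc, Matrix.one_mul]

theorem conj_conjTranspose (A : Matrix (Fin n) (Fin n) ℂ) :
    (U * A * Uᴴ)ᴴ = U * Aᴴ * Uᴴ := by
  simp [Matrix.conjTranspose_mul, Matrix.mul_assoc]

theorem conj_lie (hU : U ∈ Matrix.unitaryGroup (Fin n) ℂ) (A B : Matrix (Fin n) (Fin n) ℂ) :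
    ⁅U * A * Uᴴ, U * B * Uᴴ⁆ = U * ⁅A, B⁆ * Uᴴ := by
  rw [Ring.lie_def, Ring.lie_def, conj_mul hU, conj_mul hU, Matrix.mul_sub, Matrix.sub_mul]

theorem normSq_conj (hU : U ∈ Matrix.unitaryGroup (Fin n) ℂ) (A : Matrix (Fin n) (Fin n) ℂ) :
    normSq (U * A * Uᴴ) = normSq A := by
  have h : Uᴴ * U = 1 := Matrix.mem_unitaryGroup_iff'.1 hU
  rw [normSq, conj_conjTranspose, conj_mul hU, Matrix.trace_mul_comm, ← Matrix.mul_assoc, h,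
    Matrix.one_mul, normSq]

theorem K_conj (hU : U ∈ Matrix.unitaryGroup (Fin n) ℂ) (A : Matrix (Fin n) (Fin n) ℂ) :
    K (U * A * Uᴴ) = K A := by
  rw [K, K, conj_conjTranspose, conj_lie hU, normSq_conj hU, normSq_conj hU]

end conj

theorem normSq_smul {n : ℕ} (c : ℂ) (A : Matrix (Fin n) (Fin n) ℂ) :
    normSq (c • A) = ‖c‖ ^ 2 * normSq A := by
  simp only [normSq_eq_sum, Matrix.smul_apply, smul_eq_mul, norm_mul, mul_pow, Finset.mul_sum]

theorem K_smul {n : ℕ} {c : ℂ} (hc : c ≠ 0) (A : Matrix (Fin n) (Fin n) ℂ) :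
    K (c • A) = K A := by
  have h : ⁅c • A, (c • A)ᴴ⁆ = (c * star c) • ⁅A, Aᴴ⁆ := by
    rw [Matrix.conjTranspose_smul, Ring.lie_def, Ring.lie_def, smul_mul_smul_comm,
      smul_mul_smul_comm, smul_sub, mul_comm (star c) c]
  have hc' : ‖c‖ ≠ 0 := norm_ne_zero_iff.2 hc
  rw [K, K, h, normSq_smul, normSq_smul, norm_mul, norm_star]
  rcases eq_or_ne (normSq A) 0 with h0 | h0
  · simp [h0]
  · field_simp

/-- The square distance from a matrix to a real diagonal matrix. -/
theorem normSq_sub_diagonal {n : ℕ} (M : Matrix (Fin n) (Fin n) ℂ) (w : Fin n → ℝ) :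
    normSq (M - Matrix.diagonal fun i => (w i : ℂ)) =
      normSq M - 2 * ∑ i, w i * (M i i).re + ∑ i, w i ^ 2 := by
  have h : ∀ i j, ‖(M - Matrix.diagonal fun i => (w i : ℂ)) i j‖ ^ 2 =
      ‖M i j‖ ^ 2 - (if i = j then 2 * (w i * (M i j).re) - w i ^ 2 else 0) := by
    intro i j
    rw [Matrix.sub_apply, Matrix.diagonal_apply]
    split_ifs with hij
    · rw [← Complex.normSq_eq_norm_sq, ← Complex.normSq_eq_norm_sq, Complex.normSq_apply,
        Complex.normSq_apply]
      simp
      ring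
    · simp
  simp only [normSq_eq_sum, h, Finset.sum_sub_distrib, Finset.sum_ite_eq, Finset.mem_univ, if_true,
    ← Finset.mul_sum]
  ring

/-! ### The lower bound for `K` attached to a grading, and its equality case. -/

theorem re_lie_conjTranspose_apply_self {n : ℕ} (B : Matrix (Fin n) (Fin n) ℂ) (i : Fin n) :
    (⁅B, Bᴴ⁆ i i).re = ∑ j, ‖B i j‖ ^ 2 - ∑ j, ‖B j i‖ ^ 2 := by
  simp only [Ring.lie_def, Matrix.sub_apply, Matrix.mul_apply, Matrix.conjTranspose_apply,
    Complex.sub_re, Complex.re_sum]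
  congr 1 <;> refine Finset.sum_congr rfl fun j _ => ?_
  · rw [Complex.star_def, Complex.mul_conj, Complex.ofReal_re, Complex.normSq_eq_norm_sq]
  · rw [mul_comm, Complex.star_def, Complex.mul_conj, Complex.ofReal_re, Complex.normSq_eq_norm_sq]

theorem sum_mul_re_lie_conjTranspose {n : ℕ} (B : Matrix (Fin n) (Fin n) ℂ) (w : Fin n → ℝ) :
    ∑ i, w i * (⁅B, Bᴴ⁆ i i).re = ∑ i, ∑ j, (w i - w j) * ‖B i j‖ ^ 2 := by
  simp only [re_lie_conjTranspose_apply_self, mul_sub, sub_mul, Finset.sum_sub_distrib,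
    Finset.mul_sum]
  congr 1
  exact Finset.sum_comm

/-- `B` has weight at least two with respect to the grading of `ℂⁿ` by `w`. -/
def RaisesWeight {n : ℕ} (w : Fin n → ℝ) (B : Matrix (Fin n) (Fin n) ℂ) : Prop :=
  ∀ i j, B i j ≠ 0 → w j + 2 ≤ w i

namespace RaisesWeight

variable {n : ℕ} {w : Fin n → ℝ} {B : Matrix (Fin n) (Fin n) ℂ}

theorem term_nonneg (hw : RaisesWeight w B) (i j : Fin n) :
    0 ≤ (w i - w j - 2) * ‖B i j‖ ^ 2 := by
  by_cases h : B i j = 0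
  · simp [h]
  · exact mul_nonneg (by linarith [hw i j h]) (by positivity)

theorem sum_eq (B : Matrix (Fin n) (Fin n) ℂ) (w : Fin n → ℝ) :
    ∑ i, w i * (⁅B, Bᴴ⁆ i i).re - 2 * normSq B =
      ∑ i, ∑ j, (w i - w j - 2) * ‖B i j‖ ^ 2 := by
  rw [sum_mul_re_lie_conjTranspose, normSq_eq_sum]
  simp only [Finset.mul_sum, ← Finset.sum_sub_distrib]
  exact Finset.sum_congr rfl fun i _ => Finset.sum_congr rfl fun j _ => by ring

theorem sum_sq_pos (hw : RaisesWeight w B) (hB : B ≠ 0) : 0 < ∑ i, w i ^ 2 := by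
  obtain ⟨i, j, hij⟩ : ∃ i j, B i j ≠ 0 := by
    by_contra! h
    exact hB (Matrix.ext h)
  have h := hw i j hij
  by_contra! h0
  have h1 := (Finset.sum_eq_zero_iff_of_nonneg (fun i _ => sq_nonneg (w i))).1
    (le_antisymm h0 (Finset.sum_nonneg fun i _ => sq_nonneg (w i)))
  have hi : w i = 0 := by simpa using h1 i (Finset.mem_univ _)
  have hj : w j = 0 := by simpa using h1 j (Finset.mem_univ _)
  linarith

/-- Cauchy–Schwarz with explicit defects, by completing the square. Both terms on the left are
nonnegative: the first measures how far `⁅B, Bᴴ⁆` is from the optimal multiple of the weight matrix,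
the second how much of `B` has degree above 2. Hence the inequality and its equality case are read
off together. -/
theorem normSq_sub_le (hw : RaisesWeight w B) (hB : B ≠ 0) :
    normSq (⁅B, Bᴴ⁆ - Matrix.diagonal fun i =>
        ((2 * normSq B / (∑ i, w i ^ 2) * w i : ℝ) : ℂ)) +
      4 * normSq B / (∑ i, w i ^ 2) * ∑ i, ∑ j, (w i - w j - 2) * ‖B i j‖ ^ 2 =
      normSq ⁅B, Bᴴ⁆ - 4 * normSq B ^ 2 / ∑ i, w i ^ 2 := by
  have hS := hw.sum_sq_pos hB
  rw [normSq_sub_diagonal, ← sum_eq]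
  simp only [mul_assoc, mul_pow, ← Finset.mul_sum]
  field_simp
  ring

theorem le_K (hw : RaisesWeight w B) (hB : B ≠ 0) : 4 / ∑ i, w i ^ 2 ≤ K B := by
  have hS := hw.sum_sq_pos hB
  have hN := normSq_pos hB
  have h := hw.normSq_sub_le hB
  have h1 : 0 ≤ ∑ i, ∑ j, (w i - w j - 2) * ‖B i j‖ ^ 2 :=
    Finset.sum_nonneg fun i _ => Finset.sum_nonneg fun j _ => hw.term_nonneg i j
  have h2 : 0 ≤ 4 * normSq B / (∑ i, w i ^ 2) * ∑ i, ∑ j, (w i - w j - 2) * ‖B i j‖ ^ 2 := by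
    positivity
  have h3 := normSq_nonneg (⁅B, Bᴴ⁆ - Matrix.diagonal fun i =>
        ((2 * normSq B / (∑ i, w i ^ 2) * w i : ℝ) : ℂ))
  rw [K, le_div_iff₀ (by positivity), div_mul_eq_mul_div]
  linarith

theorem lie_lie_eq (hw : RaisesWeight w B) (hB : B ≠ 0) (hK : K B = 4 / ∑ i, w i ^ 2) :
    ∃ c : ℝ, 0 < c ∧ ⁅⁅B, Bᴴ⁆, B⁆ = ((2 * c ^ 2 : ℝ) : ℂ) • B := by
  have hS := hw.sum_sq_pos hB
  have hN := normSq_pos hB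
  have h := hw.normSq_sub_le hB
  have h1 : 0 ≤ ∑ i, ∑ j, (w i - w j - 2) * ‖B i j‖ ^ 2 :=
    Finset.sum_nonneg fun i _ => Finset.sum_nonneg fun j _ => hw.term_nonneg i j
  have hp : 0 < 4 * normSq B / (∑ i, w i ^ 2) := by positivity
  have h3 := normSq_nonneg (⁅B, Bᴴ⁆ - Matrix.diagonal fun i =>
        ((2 * normSq B / (∑ i, w i ^ 2) * w i : ℝ) : ℂ))
  have hK' : normSq ⁅B, Bᴴ⁆ - 4 * normSq B ^ 2 / ∑ i, w i ^ 2 = 0 := by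
    rw [K, div_eq_iff (by positivity)] at hK
    rw [hK]; ring
  rw [hK'] at h
  have h4 := mul_nonneg hp.le h1
  have h5 : ⁅B, Bᴴ⁆ = Matrix.diagonal fun i =>
        ((2 * normSq B / (∑ i, w i ^ 2) * w i : ℝ) : ℂ) :=
    sub_eq_zero.1 (normSq_eq_zero.1 (by linarith))
  have h6 : ∑ i, ∑ j, (w i - w j - 2) * ‖B i j‖ ^ 2 = 0 :=
    (mul_eq_zero.1 (show 4 * normSq B / (∑ i, w i ^ 2) *
      ∑ i, ∑ j, (w i - w j - 2) * ‖B i j‖ ^ 2 = 0 by linarith)).resolve_left hp.ne'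
  have h7 : ∀ i j, (w i - w j - 2) * ‖B i j‖ ^ 2 = 0 := fun i j =>
    (Finset.sum_eq_zero_iff_of_nonneg (fun j _ => hw.term_nonneg i j)).1
      ((Finset.sum_eq_zero_iff_of_nonneg (fun i _ =>
        Finset.sum_nonneg fun j _ => hw.term_nonneg i j)).1 h6 i (Finset.mem_univ _)) j
      (Finset.mem_univ _)
  -- `⁅B, Bᴴ⁆` is now `c²` times the weight matrix, and bracketing that matrix with an element of
  -- degree exactly 2 doubles it.
  refine ⟨√(2 * normSq B / ∑ i, w i ^ 2), Real.sqrt_pos.2 (by positivity), ?_⟩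
  rw [Real.sq_sqrt (by positivity), h5]
  ext i j
  rw [Ring.lie_def, Matrix.sub_apply, Matrix.diagonal_mul, Matrix.mul_diagonal, Matrix.smul_apply,
    smul_eq_mul]
  rcases mul_eq_zero.1 (h7 i j) with h8 | h8
  · have : w i = w j + 2 := by linarith
    rw [this]
    push_cast
    ring
  · have : B i j = 0 := by simpa using h8
    simp [this]

end RaisesWeight

end NilpotentJordan
-- Partitions, dominance, and the sum of cubics.
namespace NilpotentJordan

/-- The cubic whose sum over the parts of `lam` is `12 / C_lam`. -/
def cubic (k : ℕ) : ℝ := (k : ℝ) * ((k : ℝ) ^ 2 - 1)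

/-- The `i`-th part (counted from zero, in decreasing order) of a partition. -/
def part {n : ℕ} (lam : n.Partition) (i : ℕ) : ℕ := (sortedParts lam).blocks.getD i 0

theorem _root_.List.sum_take_eq_sum_getD (l : List ℕ) (p : ℕ) :
    (l.take p).sum = ∑ i ∈ Finset.range p, l.getD i 0 := by
  induction p with
  | zero => simp
  | succ p ih =>
    rw [Finset.sum_range_succ, ← ih]
    by_cases h : p < l.length
    · rw [List.sum_take_succ _ _ h, List.getD_eq_getElem _ _ h]
    · push Not at h
      rw [List.take_of_length_le h, List.take_of_length_le (by lia), List.getD_eq_default _ _ h,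
        add_zero]

-- The condition `f 0 = 0` makes padding by zero parts harmless, so partitions of different lengths
-- can be summed over one range.
theorem _root_.List.sum_map_eq_sum_getD (l : List ℕ) (f : ℕ → ℝ) (hf : f 0 = 0) {N : ℕ}
    (hN : l.length ≤ N) : (l.map f).sum = ∑ i ∈ Finset.range N, f (l.getD i 0) := by
  induction l generalizing N with
  | nil => simp [hf]
  | cons a l ih =>
    obtain ⟨N, rfl⟩ : ∃ M, N = M + 1 := ⟨N - 1, by simp at hN; lia⟩
    rw [Finset.sum_range_succ', List.map_cons, List.sum_cons, ih (by simpa using hN)]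
    simp [add_comm]

section part

variable {n : ℕ} (lam : n.Partition)

theorem part_succ_le (i : ℕ) : part lam (i + 1) ≤ part lam i := by
  have h : (sortedParts lam).blocks.Pairwise (· ≥ ·) := Multiset.pairwise_sort lam.parts (· ≥ ·)
  by_cases hi : i + 1 < (sortedParts lam).blocks.length
  · rw [part, part, List.getD_eq_getElem _ _ hi, List.getD_eq_getElem _ _ (by lia)]
    exact List.pairwise_iff_getElem.1 h i (i + 1) (by lia) hi (by lia)
  · rw [part, List.getD_eq_default _ _ (by lia)]
    exact Nat.zero_le _

theorem sum_parts_map (f : ℕ → ℝ) (hf : f 0 = 0) :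
    (lam.parts.map f).sum = ∑ i ∈ Finset.range n, f (part lam i) := by
  have h : lam.parts = ((sortedParts lam).blocks : Multiset ℕ) :=
    (Multiset.sort_eq lam.parts (· ≥ ·)).symm
  rw [h, Multiset.map_coe, Multiset.sum_coe]
  exact List.sum_map_eq_sum_getD _ f hf (sortedParts lam).length_le

theorem sum_part : ∑ i ∈ Finset.range n, (part lam i : ℝ) = n := by
  rw [← sum_parts_map lam (fun k => (k : ℝ)) (by simp)]
  have := lam.parts_sum
  rw [← Nat.cast_multiset_sum, this]

theorem part_injective {mu : n.Partition} (h : ∀ i < n, part mu i = part lam i) : mu = lam := by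
  have h1 : ∀ i, part mu i = part lam i := by
    intro i
    by_cases hi : i < n
    · exact h i hi
    · rw [part, part, List.getD_eq_default _ _ ((sortedParts mu).length_le.trans (by lia)),
        List.getD_eq_default _ _ ((sortedParts lam).length_le.trans (by lia))]
  ext k
  rcases Nat.eq_zero_or_pos k with rfl | hk
  · rw [Multiset.count_eq_zero_of_notMem fun h => (mu.parts_pos h).ne rfl,
      Multiset.count_eq_zero_of_notMem fun h => (lam.parts_pos h).ne rfl]
  · have h3 : ∀ nu : n.Partition, (nu.parts.count k : ℝ) =
        (nu.parts.map (fun m => if k = m then (1 : ℝ) else 0)).sum := by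
      intro nu
      induction nu.parts using Multiset.induction with
      | empty => simp
      | cons a s ih =>
        rw [Multiset.count_cons, Multiset.map_cons, Multiset.sum_cons, ← ih]
        push_cast
        ring
    have h4 : (mu.parts.count k : ℝ) = lam.parts.count k := by
      rw [h3, h3, sum_parts_map _ _ (if_neg hk.ne'), sum_parts_map _ _ (if_neg hk.ne')]
      simp only [h1]
    exact_mod_cast h4

end part

/-- Abel summation: pairing nonnegative partial sums with a decreasing sequence. -/
theorem sum_mul_nonneg_of_partial_sums (d g : ℕ → ℝ) (hg : ∀ i, g (i + 1) ≤ g i)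
    (hd : ∀ p, 0 ≤ ∑ i ∈ Finset.range p, d i) (N : ℕ) :
    g N * ∑ i ∈ Finset.range N, d i ≤ ∑ i ∈ Finset.range N, g i * d i := by
  induction N with
  | zero => simp
  | succ N ih =>
    rw [Finset.sum_range_succ (fun i => g i * d i)]
    calc g (N + 1) * ∑ i ∈ Finset.range (N + 1), d i
        ≤ g N * ∑ i ∈ Finset.range (N + 1), d i := mul_le_mul_of_nonneg_right (hg N) (hd _)
      _ = g N * ∑ i ∈ Finset.range N, d i + g N * d N := by rw [Finset.sum_range_succ]; ring
      _ ≤ _ := by linarith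

/-- Since `l³ - m³ = 3 m² (l - m) + (l - m)² (l + 2 m)`, the correction term is the exact convexity
remainder. The tangent terms `3 m² (l - m)` have nonnegative sum by Abel summation, because `m`
decreases and dominance makes the partial sums of `l - m` nonnegative. The linear parts of `cubic`
cancel, as both partitions sum to `n`. -/
theorem cubic_sum_add_le {n : ℕ} {mu lam : n.Partition} (h : DominatedBy mu lam) :
    (mu.parts.map cubic).sum + ∑ i ∈ Finset.range n,
      ((part lam i : ℝ) - part mu i) ^ 2 * (part lam i + 2 * part mu i) ≤
      (lam.parts.map cubic).sum := by
  have hd : ∀ p, 0 ≤ ∑ i ∈ Finset.range p, ((part lam i : ℝ) - part mu i) := by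
    intro p
    have h1 := h p
    rw [List.sum_take_eq_sum_getD, List.sum_take_eq_sum_getD] at h1
    rw [Finset.sum_sub_distrib, sub_nonneg]
    exact_mod_cast h1
  have h2 := sum_mul_nonneg_of_partial_sums (fun i => (part lam i : ℝ) - part mu i)
    (fun i => 3 * (part mu i : ℝ) ^ 2)
    (fun i => by
      have : (part mu (i + 1) : ℝ) ≤ part mu i := by exact_mod_cast part_succ_le mu i
      gcongr) hd n
  have h3 := mul_nonneg (show 0 ≤ 3 * (part mu n : ℝ) ^ 2 by positivity) (hd n)
  have h4 := sum_part lam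
  have h5 := sum_part mu
  rw [sum_parts_map _ _ (by simp [cubic]), sum_parts_map _ _ (by simp [cubic])]
  have h6 : ∑ i ∈ Finset.range n, cubic (part lam i) -
      (∑ i ∈ Finset.range n, cubic (part mu i) + ∑ i ∈ Finset.range n,
        ((part lam i : ℝ) - part mu i) ^ 2 * (part lam i + 2 * part mu i)) =
      ∑ i ∈ Finset.range n, 3 * (part mu i : ℝ) ^ 2 * ((part lam i : ℝ) - part mu i) -
      (∑ i ∈ Finset.range n, (part lam i : ℝ) - ∑ i ∈ Finset.range n, (part mu i : ℝ)) := by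
    simp only [← Finset.sum_sub_distrib, ← Finset.sum_add_distrib]
    refine Finset.sum_congr rfl fun i _ => ?_
    simp only [cubic]
    ring
  linarith

theorem cubic_sum_le {n : ℕ} {mu lam : n.Partition} (h : DominatedBy mu lam) :
    (mu.parts.map cubic).sum ≤ (lam.parts.map cubic).sum :=
  le_trans (le_add_of_nonneg_right (Finset.sum_nonneg fun i _ => by positivity))
    (cubic_sum_add_le h)

theorem DominatedBy.eq_of_cubic_sum_eq {n : ℕ} {mu lam : n.Partition} (h : DominatedBy mu lam)
    (he : (mu.parts.map cubic).sum = (lam.parts.map cubic).sum) : mu = lam := by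
  have h1 := cubic_sum_add_le h
  have h2 : ∑ i ∈ Finset.range n,
      ((part lam i : ℝ) - part mu i) ^ 2 * (part lam i + 2 * part mu i) = 0 :=
    le_antisymm (by linarith) (Finset.sum_nonneg fun i _ => by positivity)
  rw [Finset.sum_eq_zero_iff_of_nonneg (fun i _ => by positivity)] at h2
  refine part_injective lam fun i hi => ?_
  rcases mul_eq_zero.1 (h2 i (Finset.mem_range.2 hi)) with h3 | h3
  · have : (part lam i : ℝ) = part mu i := sub_eq_zero.1 (pow_eq_zero_iff two_ne_zero |>.1 h3)
    exact_mod_cast this.symm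
  · have h4 : part lam i + 2 * part mu i = 0 := by exact_mod_cast h3
    lia

theorem sortedParts_indiscrete_blocks {n : ℕ} (hn : n ≠ 0) :
    (sortedParts (Nat.Partition.indiscrete n)).blocks = [n] := by
  simp [sortedParts, Nat.Partition.indiscrete_parts hn]

theorem dominatedBy_indiscrete {n : ℕ} (hn : n ≠ 0) (mu : n.Partition) :
    DominatedBy mu (Nat.Partition.indiscrete n) := by
  intro p
  rw [sortedParts_indiscrete_blocks hn]
  rcases p with _ | p
  · simp
  · have h := (List.sum_take_add_sum_drop (sortedParts mu).blocks (p + 1)).trans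
      (sortedParts mu).blocks_sum
    simp only [List.take_succ_cons, List.take_nil, List.sum_cons, List.sum_nil]
    lia

theorem sum_map_sub_eq (s : Multiset ℕ) (q : ℕ) :
    (s.map (· - q)).sum = (s.map (· - (q + 1))).sum + s.countP (q < ·) := by
  induction s using Multiset.induction with
  | empty => simp
  | cons a s ih =>
    simp only [Multiset.map_cons, Multiset.sum_cons, Multiset.countP_cons, ih]
    split_ifs <;> lia

theorem countP_lt_eq (s : Multiset ℕ) (q : ℕ) :
    s.countP (q < ·) = s.count (q + 1) + s.countP (q + 1 < ·) := by
  induction s using Multiset.induction with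
  | empty => simp
  | cons a s ih =>
    simp only [Multiset.count_cons, Multiset.countP_cons, ih]
    split_ifs <;> lia

/-- With truncated subtraction these sums are the ranks of the powers of a nilpotent matrix.
Consecutive differences count the parts exceeding `q`, and second differences give the
multiplicities. -/
theorem partition_eq_of_sum_map_sub_eq {n : ℕ} {mu lam : n.Partition}
    (h : ∀ q, (mu.parts.map (· - q)).sum = (lam.parts.map (· - q)).sum) : mu = lam := by
  have h1 : ∀ q, mu.parts.countP (q < ·) = lam.parts.countP (q < ·) := by
    intro q
    have h2 := h q
    rw [sum_map_sub_eq mu.parts, sum_map_sub_eq lam.parts, h (q + 1)] at h2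
    exact Nat.add_left_cancel h2
  ext k
  rcases k with _ | k
  · rw [Multiset.count_eq_zero_of_notMem fun h => (mu.parts_pos h).ne rfl,
      Multiset.count_eq_zero_of_notMem fun h => (lam.parts_pos h).ne rfl]
  · have h2 := h1 k
    rw [countP_lt_eq mu.parts, countP_lt_eq lam.parts, h1 (k + 1)] at h2
    exact Nat.add_right_cancel h2

end NilpotentJordan
namespace NilpotentJordan

/-! ### Algebra of block diagonal matrices. -/

section blockMatrix

variable {n : ℕ} (lam : n.Partition)

theorem sum_blocksFun_eq {M : Type*} [AddCommMonoid M] (f : ℕ → M) :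
    ∑ p, f ((sortedParts lam).blocksFun p) = (lam.parts.map f).sum := by
  have h : lam.parts = ((sortedParts lam).blocks : Multiset ℕ) :=
    (Multiset.sort_eq lam.parts (· ≥ ·)).symm
  rw [h, Multiset.map_coe, Multiset.sum_coe, ← (sortedParts lam).ofFn_blocksFun, List.map_ofFn,
    List.sum_ofFn]
  rfl

theorem blockMatrix_eq_reindexAlgEquiv (B : (i : ℕ) → Matrix (Fin i) (Fin i) ℂ) :
    blockMatrix B lam = Matrix.reindexAlgEquiv ℂ ℂ (sortedParts lam).blocksFinEquiv
      (Matrix.blockDiagonal' fun p : Fin (sortedParts lam).length =>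
        B ((sortedParts lam).blocksFun p)) := rfl

theorem blockMatrix_apply (B : (i : ℕ) → Matrix (Fin i) (Fin i) ℂ)
    (x y : Σ p : Fin (sortedParts lam).length, Fin ((sortedParts lam).blocksFun p)) :
    blockMatrix B lam ((sortedParts lam).blocksFinEquiv x) ((sortedParts lam).blocksFinEquiv y) =
      Matrix.blockDiagonal' (fun p : Fin (sortedParts lam).length =>
        B ((sortedParts lam).blocksFun p)) x y := by
  simp [blockMatrix]

theorem blockMatrix_pow (B : (i : ℕ) → Matrix (Fin i) (Fin i) ℂ) (q : ℕ) :
    blockMatrix B lam ^ q = blockMatrix (fun i => B i ^ q) lam := by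
  rw [blockMatrix_eq_reindexAlgEquiv, blockMatrix_eq_reindexAlgEquiv, ← map_pow,
    ← Matrix.blockDiagonal'_pow]
  rfl

theorem blockMatrix_conjTranspose (B : (i : ℕ) → Matrix (Fin i) (Fin i) ℂ) :
    (blockMatrix B lam)ᴴ = blockMatrix (fun i => (B i)ᴴ) lam := by
  rw [blockMatrix, Matrix.conjTranspose_reindex, Matrix.blockDiagonal'_conjTranspose]
  rfl

theorem blockMatrix_mul (B C : (i : ℕ) → Matrix (Fin i) (Fin i) ℂ) :
    blockMatrix B lam * blockMatrix C lam = blockMatrix (fun i => B i * C i) lam := by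
  rw [blockMatrix_eq_reindexAlgEquiv, blockMatrix_eq_reindexAlgEquiv, ← map_mul,
    ← Matrix.blockDiagonal'_mul]
  rfl

theorem blockMatrix_sub (B C : (i : ℕ) → Matrix (Fin i) (Fin i) ℂ) :
    blockMatrix B lam - blockMatrix C lam = blockMatrix (fun i => B i - C i) lam := by
  rw [blockMatrix_eq_reindexAlgEquiv, blockMatrix_eq_reindexAlgEquiv, ← map_sub,
    ← Matrix.blockDiagonal'_sub]
  rfl

theorem smul_blockMatrix (c : ℂ) (B : (i : ℕ) → Matrix (Fin i) (Fin i) ℂ) :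
    c • blockMatrix B lam = blockMatrix (fun i => c • B i) lam := by
  rw [blockMatrix_eq_reindexAlgEquiv, ← map_smul, ← Matrix.blockDiagonal'_smul]
  rfl

theorem normSq_blockMatrix (B : (i : ℕ) → Matrix (Fin i) (Fin i) ℂ) :
    normSq (blockMatrix B lam) = (lam.parts.map fun k => normSq (B k)).sum := by
  rw [normSq, blockMatrix_conjTranspose, blockMatrix_mul, ← sum_blocksFun_eq, Matrix.trace,
    ← (sortedParts lam).blocksFinEquiv.sum_comp]
  simp only [Matrix.diag_apply, blockMatrix_apply, Fintype.sum_sigma,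
    Matrix.blockDiagonal'_apply_eq, Complex.re_sum, normSq, Matrix.trace]

theorem lie_blockMatrix (B : (i : ℕ) → Matrix (Fin i) (Fin i) ℂ) :
    ⁅blockMatrix B lam, (blockMatrix B lam)ᴴ⁆ = blockMatrix (fun i => ⁅B i, (B i)ᴴ⁆) lam := by
  rw [Ring.lie_def, blockMatrix_conjTranspose, blockMatrix_mul, blockMatrix_mul, blockMatrix_sub]
  rfl

end blockMatrix

/-! ### Norms and commutators of the normalized blocks, and the value of `C_λ`. -/

section elementaryBlock

theorem _root_.Fin.sum_coe_mul_sub (k : ℕ) :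
    ∑ a : Fin k, (a : ℝ) * ((k : ℝ) - a) = cubic k / 6 := by
  have h : ∀ m : ℕ, ∑ a ∈ Finset.range m, (a : ℝ) * ((k : ℝ) - a) =
      k * ((m : ℝ) * (m - 1) / 2) - (m : ℝ) * (m - 1) * (2 * m - 1) / 6 := by
    intro m
    induction m with
    | zero => simp
    | succ m ih => rw [Finset.sum_range_succ, ih]; push_cast; ring
  rw [Fin.sum_univ_eq_sum_range (fun a : ℕ => (a : ℝ) * ((k : ℝ) - a)), h, cubic]
  ring

theorem _root_.Fin.sum_weight_sq (k : ℕ) :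
    ∑ a : Fin k, (2 * (a : ℝ) + 1 - k) ^ 2 = cubic k / 3 := by
  have h : ∀ m : ℕ, ∑ a ∈ Finset.range m, (2 * (a : ℝ) + 1 - k) ^ 2 =
      4 * ((m : ℝ) * (m - 1) * (2 * m - 1) / 6) + 4 * (1 - (k : ℝ)) * ((m : ℝ) * (m - 1) / 2) +
        m * (1 - (k : ℝ)) ^ 2 := by
    intro m
    induction m with
    | zero => simp
    | succ m ih => rw [Finset.sum_range_succ, ih]; push_cast; ring
  rw [Fin.sum_univ_eq_sum_range (fun a : ℕ => (2 * (a : ℝ) + 1 - k) ^ 2), h, cubic]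
  ring

theorem norm_elementaryBlock_sq {k : ℕ} (a b : Fin k) :
    ‖elementaryBlock k a b‖ ^ 2 = if (a : ℕ) = b + 1 then (a : ℝ) * ((k : ℝ) - a) else 0 := by
  have h : (a : ℝ) ≤ k := by exact_mod_cast a.2.le
  rw [elementaryBlock, subdiagonal, Matrix.of_apply]
  split_ifs
  · rw [Complex.norm_real, Real.norm_eq_abs, sq_abs, Real.sq_sqrt]
    exact mul_nonneg (by positivity) (by linarith)
  · simp

theorem sum_row_elementaryBlock {k : ℕ} (a : Fin k) :
    ∑ b, ‖elementaryBlock k a b‖ ^ 2 = (a : ℝ) * ((k : ℝ) - a) := by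
  simp only [norm_elementaryBlock_sq]
  by_cases ha : (a : ℕ) = 0
  · simp [ha]
  · rw [Finset.sum_eq_single ⟨a - 1, by lia⟩, if_pos (by simp; lia)]
    · intro b _ hb
      refine if_neg fun h => hb (Fin.ext ?_)
      simp [h]
    · simp

theorem sum_column_elementaryBlock {k : ℕ} (b : Fin k) :
    ∑ a, ‖elementaryBlock k a b‖ ^ 2 = ((b : ℝ) + 1) * ((k : ℝ) - (b + 1)) := by
  simp only [norm_elementaryBlock_sq]
  by_cases hb : (b : ℕ) + 1 < k
  · rw [Finset.sum_eq_single ⟨b + 1, hb⟩, if_pos rfl]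
    · push_cast
      ring
    · exact fun a _ ha => if_neg fun h => ha (Fin.ext h)
    · simp
  · have hk : (k : ℝ) = b + 1 := by exact_mod_cast (show k = b + 1 by lia)
    rw [hk, sub_self, mul_zero]
    exact Finset.sum_eq_zero fun a _ => if_neg (by lia)

theorem normSq_elementaryBlock (k : ℕ) : normSq (elementaryBlock k) = cubic k / 6 := by
  rw [normSq_eq_sum]
  simp only [sum_row_elementaryBlock, Fin.sum_coe_mul_sub]

theorem lie_elementaryBlock (k : ℕ) :
    ⁅elementaryBlock k, (elementaryBlock k)ᴴ⁆ =
      Matrix.diagonal fun a : Fin k => ((2 * (a : ℝ) + 1 - k : ℝ) : ℂ) := by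
  ext a b
  rw [Matrix.diagonal_apply, Ring.lie_def, Matrix.sub_apply, Matrix.mul_apply, Matrix.mul_apply]
  simp only [Matrix.conjTranspose_apply]
  split_ifs with hab
  · subst hab
    have h1 : ∑ c, elementaryBlock k a c * star (elementaryBlock k a c) =
        ((∑ c, ‖elementaryBlock k a c‖ ^ 2 : ℝ) : ℂ) := by
      push_cast
      exact Finset.sum_congr rfl fun c _ => Complex.mul_conj' _
    have h2 : ∑ c, star (elementaryBlock k c a) * elementaryBlock k c a =
        ((∑ c, ‖elementaryBlock k c a‖ ^ 2 : ℝ) : ℂ) := by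
      push_cast
      exact Finset.sum_congr rfl fun c _ => Complex.conj_mul' _
    rw [h1, h2, sum_row_elementaryBlock, sum_column_elementaryBlock]
    push_cast
    ring
  · have hab' : (a : ℕ) ≠ b := fun h => hab (Fin.ext h)
    rw [Finset.sum_eq_zero, Finset.sum_eq_zero, sub_zero]
    · intro c _
      simp only [elementaryBlock, subdiagonal, Matrix.of_apply]
      split_ifs <;> first | lia | simp
    · intro c _
      simp only [elementaryBlock, subdiagonal, Matrix.of_apply]
      split_ifs <;> first | lia | simp

theorem normSq_lie_elementaryBlock (k : ℕ) :
    normSq ⁅elementaryBlock k, (elementaryBlock k)ᴴ⁆ = cubic k / 3 := by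
  rw [lie_elementaryBlock, normSq_eq_sum, ← Fin.sum_weight_sq]
  refine Finset.sum_congr rfl fun a _ => ?_
  rw [Finset.sum_eq_single a]
  · rw [Matrix.diagonal_apply_eq, Complex.norm_real, Real.norm_eq_abs, sq_abs]
  · intro b _ hb
    rw [Matrix.diagonal_apply_ne _ hb.symm]
    simp
  · simp

/-- With division by zero equal to zero, the case `s = 0` lets the formula for `jordanConst` hold
even when `X^λ = 0`. -/
theorem twelve_div_aux (s : ℝ) : s / 3 / (s / 6) ^ 2 = 12 / s := by
  rcases eq_or_ne s 0 with rfl | hs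
  · simp
  · field_simp
    norm_num

theorem K_elementaryBlock (k : ℕ) : K (elementaryBlock k) = 12 / cubic k := by
  rw [K, normSq_lie_elementaryBlock, normSq_elementaryBlock, twelve_div_aux]

theorem jordanConst_eq {n : ℕ} (lam : n.Partition) :
    jordanConst lam = 12 / (lam.parts.map cubic).sum := by
  have h : ∀ r : ℝ, (lam.parts.map fun k => cubic k / r).sum = (lam.parts.map cubic).sum / r := by
    intro r
    simp only [div_eq_mul_inv, Multiset.sum_map_mul_right]
  rw [jordanConst, K, stdNilpotent, lie_blockMatrix, normSq_blockMatrix, normSq_blockMatrix]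
  simp only [normSq_lie_elementaryBlock, normSq_elementaryBlock, h, twelve_div_aux]

theorem stdNilpotent_indiscrete {n : ℕ} (hn : n ≠ 0) :
    stdNilpotent (Nat.Partition.indiscrete n) = elementaryBlock n := by
  set c := sortedParts (Nat.Partition.indiscrete n)
  have hb : c.blocks = [n] := sortedParts_indiscrete_blocks hn
  have hl : c.length = 1 := by rw [Composition.length, hb]; rfl
  have hp : ∀ p : Fin c.length, (p : ℕ) = 0 := fun p => by have := p.2; lia
  have hf : ∀ p : Fin c.length, c.blocksFun p = n := by
    intro p
    rw [← List.mem_singleton, ← hb]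
    exact c.blocksFun_mem_blocks p
  ext x y
  obtain ⟨⟨p, a⟩, rfl⟩ := c.blocksFinEquiv.surjective x
  obtain ⟨⟨q, b⟩, rfl⟩ := c.blocksFinEquiv.surjective y
  obtain rfl : p = q := Fin.ext ((hp p).trans (hp q).symm)
  have hv : ∀ a : Fin (c.blocksFun p), (c.blocksFinEquiv ⟨p, a⟩ : ℕ) = a := by
    intro a
    change (c.embedding p a : ℕ) = a
    rw [c.coe_embedding, hp p, c.sizeUpTo_zero, zero_add]
  rw [stdNilpotent, blockMatrix_apply, Matrix.blockDiagonal'_apply_eq]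
  simp only [elementaryBlock, subdiagonal, Matrix.of_apply]
  rw [hv, hv]
  have h : (((sortedParts (Nat.Partition.indiscrete n)).blocksFun p : ℕ) : ℝ) = n :=
    congrArg _ (hf p)
  rw [h]

end elementaryBlock

/-! ### The sl(2)-weights attached to a partition. -/

section weight

variable {n : ℕ} (lam : n.Partition)

/-- The weights of the neutral element `[X, X*]`, `X = X^lam`, on the standard basis vectors. -/
noncomputable def weight (x : Fin n) : ℝ :=
  2 * ((((sortedParts lam).blocksFinEquiv.symm x).2 : ℕ) : ℝ) + 1 -
    (sortedParts lam).blocksFun ((sortedParts lam).blocksFinEquiv.symm x).1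

theorem weight_apply (p : Fin (sortedParts lam).length) (a : Fin ((sortedParts lam).blocksFun p)) :
    weight lam ((sortedParts lam).blocksFinEquiv ⟨p, a⟩) =
      2 * (a : ℝ) + 1 - (sortedParts lam).blocksFun p := by
  rw [weight, Equiv.symm_apply_apply]

theorem sum_weight_sq : ∑ x, weight lam x ^ 2 = (lam.parts.map cubic).sum / 3 := by
  rw [← (sortedParts lam).blocksFinEquiv.sum_comp, Fintype.sum_sigma]
  simp only [weight_apply, Fin.sum_weight_sq]
  rw [← Finset.sum_div, sum_blocksFun_eq]

theorem raisesWeight_jordanForm : RaisesWeight (weight lam) (jordanForm lam) := by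
  intro x y hxy
  obtain ⟨⟨p, a⟩, rfl⟩ := (sortedParts lam).blocksFinEquiv.surjective x
  obtain ⟨⟨q, b⟩, rfl⟩ := (sortedParts lam).blocksFinEquiv.surjective y
  rw [jordanForm, blockMatrix_apply] at hxy
  by_cases hpq : p = q
  · subst hpq
    rw [Matrix.blockDiagonal'_apply_eq, nilpotentBlock, subdiagonal, Matrix.of_apply] at hxy
    have hab : (a : ℕ) = b + 1 := by
      by_contra h
      exact hxy (if_neg h)
    rw [weight_apply, weight_apply, hab]
    push_cast
    linarith
  · exact absurd (Matrix.blockDiagonal'_apply_ne _ _ _ hpq) hxy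

end weight

/-! ### Ranks of powers of block matrices. -/

section rank

open scoped ComplexOrder in
/-- A matrix having at most one nonzero entry in each row has as many independent columns as
nonzero columns. -/
theorem rank_eq_card_of_row {n : ℕ} (M : Matrix (Fin n) (Fin n) ℂ)
    (h : ∀ x y z, M x y ≠ 0 → M x z ≠ 0 → y = z) :
    M.rank = Fintype.card {y // ∑ x, ‖M x y‖ ^ 2 ≠ 0} := by
  -- Distinct columns have disjoint supports, so the Gram matrix is diagonal.
  have h1 : Mᴴ * M = Matrix.diagonal fun y => ((∑ x, ‖M x y‖ ^ 2 : ℝ) : ℂ) := by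
    ext y z
    rw [Matrix.mul_apply, Matrix.diagonal_apply]
    simp only [Matrix.conjTranspose_apply]
    split_ifs with hyz
    · subst hyz
      push_cast
      exact Finset.sum_congr rfl fun c _ => Complex.conj_mul' _
    · refine Finset.sum_eq_zero fun x _ => ?_
      by_contra h2
      exact hyz (h x y z (star_ne_zero.1 (left_ne_zero_of_mul h2)) (right_ne_zero_of_mul h2))
  rw [← Matrix.rank_conjTranspose_mul_self, h1, Matrix.rank_diagonal]
  exact Fintype.card_congr (Equiv.subtypeEquivRight fun y => by rw [Ne, Complex.ofReal_eq_zero])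

theorem subdiagonal_pow_apply_ne_zero_iff {k : ℕ} {r : ℕ → ℂ} (hr : ∀ a, 0 < a → a < k → r a ≠ 0)
    (q : ℕ) (a b : Fin k) : (subdiagonal k r ^ q) a b ≠ 0 ↔ (a : ℕ) = b + q := by
  induction q generalizing a with
  | zero => rw [pow_zero, Matrix.one_apply, add_zero, ← Fin.ext_iff]; simp
  | succ q ih =>
    rw [pow_succ', Matrix.mul_apply]
    by_cases ha : (a : ℕ) = 0
    · rw [Finset.sum_eq_zero]
      · simp [ha]
      · intro c _
        rw [subdiagonal, Matrix.of_apply, if_neg (by lia), zero_mul]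
    · rw [Finset.sum_eq_single ⟨a - 1, by lia⟩]
      · rw [mul_ne_zero_iff, ih, subdiagonal, Matrix.of_apply, if_pos (by simp; lia)]
        simp only [hr a (by lia) a.2, ne_eq, not_false_eq_true, true_and]
        lia
      · intro c _ hc
        rw [subdiagonal, Matrix.of_apply, if_neg, zero_mul]
        exact fun h => hc (Fin.ext (by simp [h]))
      · simp

theorem card_fin_add_lt (k q : ℕ) : Fintype.card {b : Fin k // (b : ℕ) + q < k} = k - q := by
  rw [← Fintype.card_fin (k - q)]
  exact Fintype.card_congr
    { toFun := fun b => ⟨b.1, by have := b.2; lia⟩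
      invFun := fun b => ⟨⟨b, by have := b.2; lia⟩, by have := b.2; simp; lia⟩
      left_inv := fun b => rfl
      right_inv := fun b => rfl }

/-- The subdiagonal entries need only be nonzero, so this covers both Jordan forms and the nonzero
multiples of `X^λ`. -/
theorem rank_blockMatrix_pow {n : ℕ} (lam : n.Partition) {r : ℕ → ℕ → ℂ}
    (hr : ∀ k a, 0 < a → a < k → r k a ≠ 0) (q : ℕ) :
    (blockMatrix (fun k => subdiagonal k (r k)) lam ^ q).rank =
      (lam.parts.map (· - q)).sum := by
  have key : ∀ p a p' b, blockMatrix (fun k => subdiagonal k (r k) ^ q) lam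
      ((sortedParts lam).blocksFinEquiv ⟨p, a⟩) ((sortedParts lam).blocksFinEquiv ⟨p', b⟩) ≠ 0 ↔
      p = p' ∧ (a : ℕ) = b + q := by
    intro p a p' b
    rw [blockMatrix_apply]
    by_cases hp : p = p'
    · subst hp
      rw [Matrix.blockDiagonal'_apply_eq, subdiagonal_pow_apply_ne_zero_iff (hr _)]
      simp
    · rw [Matrix.blockDiagonal'_apply_ne _ _ _ hp]
      simp [hp]
  rw [blockMatrix_pow, rank_eq_card_of_row, ← sum_blocksFun_eq]
  · simp only [← card_fin_add_lt, Fintype.card_subtype, Finset.card_filter]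
    rw [← (sortedParts lam).blocksFinEquiv.sum_comp, Fintype.sum_sigma]
    refine Finset.sum_congr rfl fun p _ => Finset.sum_congr rfl fun b _ => if_congr ?_ rfl rfl
    rw [Ne, Finset.sum_eq_zero_iff_of_nonneg (fun _ _ => by positivity)]
    simp only [Finset.mem_univ, true_imp_iff, pow_eq_zero_iff two_ne_zero, norm_eq_zero, not_forall]
    constructor
    · rintro ⟨x, hx⟩
      obtain ⟨⟨p', a⟩, rfl⟩ := (sortedParts lam).blocksFinEquiv.surjective x
      obtain ⟨rfl, h1⟩ := (key _ _ _ _).1 hx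
      exact h1 ▸ a.2
    · exact fun h => ⟨_, (key p ⟨b + q, h⟩ p b).2 ⟨rfl, rfl⟩⟩
  · intro x y z hxy hxz
    obtain ⟨⟨p, a⟩, rfl⟩ := (sortedParts lam).blocksFinEquiv.surjective x
    obtain ⟨⟨p', b⟩, rfl⟩ := (sortedParts lam).blocksFinEquiv.surjective y
    obtain ⟨⟨p'', c⟩, rfl⟩ := (sortedParts lam).blocksFinEquiv.surjective z
    obtain ⟨rfl, h1⟩ := (key _ _ _ _).1 hxy
    obtain ⟨rfl, h2⟩ := (key _ _ _ _).1 hxz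
    obtain rfl : b = c := Fin.ext (by lia)
    rfl

end rank

end NilpotentJordan
namespace NilpotentJordan

/-! ### Unitary matrices from orthonormal bases, and triangularization. -/

section orthonormalBasis

variable {n : ℕ} (b : OrthonormalBasis (Fin n) ℂ (EuclideanSpace ℂ (Fin n)))

/-- The unitary matrix whose columns are the vectors of an orthonormal basis. -/
noncomputable def columnMatrix : Matrix (Fin n) (Fin n) ℂ := Matrix.of fun k j => b j k

theorem columnMatrix_mem : columnMatrix b ∈ Matrix.unitaryGroup (Fin n) ℂ :=
  (EuclideanSpace.basisFun (Fin n) ℂ).toMatrix_orthonormalBasis_mem_unitary b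

theorem columnMatrix_conjTranspose_mulVec (v : EuclideanSpace ℂ (Fin n)) (j : Fin n) :
    ((columnMatrix b)ᴴ *ᵥ v.ofLp) j = inner ℂ (b j) v := by
  rw [PiLp.inner_apply]
  simp only [Matrix.mulVec, dotProduct, Matrix.conjTranspose_apply, columnMatrix, Matrix.of_apply]
  exact Finset.sum_congr rfl fun k _ => mul_comm _ _

theorem columnMatrix_conj_apply (A : Matrix (Fin n) (Fin n) ℂ) (j i : Fin n) :
    ((columnMatrix b)ᴴ * A * columnMatrix b) j i =
      inner ℂ (b j) (Matrix.toEuclideanLin A (b i)) := by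
  rw [← columnMatrix_conjTranspose_mulVec, Matrix.mul_assoc]
  rfl

end orthonormalBasis

section triangular

variable {n : ℕ}

/-- This is the QR decomposition: Gram–Schmidt applied to the columns of `P`. -/
theorem exists_unitary_isUpperTriangular (P : Matrix (Fin n) (Fin n) ℂ) :
    ∃ U ∈ Matrix.unitaryGroup (Fin n) ℂ, (Uᴴ * P).IsUpperTriangular := by
  let f : Fin n → EuclideanSpace ℂ (Fin n) := fun i => WithLp.toLp 2 fun k => P k i
  let b := InnerProductSpace.gramSchmidtOrthonormalBasis (𝕜 := ℂ)
    (by simp : Module.finrank ℂ (EuclideanSpace ℂ (Fin n)) = Fintype.card (Fin n)) f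
  refine ⟨columnMatrix b, columnMatrix_mem b, fun j i hij => ?_⟩
  exact (columnMatrix_conjTranspose_mulVec b (f i) j).trans
    (InnerProductSpace.gramSchmidtOrthonormalBasis_inv_triangular _ f hij)

/-- When weights decrease along the basis, an upper triangular matrix never lowers weight, so
multiplying by one on either side keeps the gain of 2. -/
theorem RaisesWeight.conj_isUpperTriangular {w : Fin n → ℝ} (hw : Antitone w)
    {J : Matrix (Fin n) (Fin n) ℂ} (hJ : RaisesWeight w J) {T S : Matrix (Fin n) (Fin n) ℂ}
    (hT : T.IsUpperTriangular) (hS : S.IsUpperTriangular) : RaisesWeight w (T * J * S) := by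
  intro i j hij
  rw [Matrix.mul_apply] at hij
  obtain ⟨l, -, hl⟩ := Finset.exists_ne_zero_of_sum_ne_zero hij
  have hl1 := left_ne_zero_of_mul hl
  rw [Matrix.mul_apply] at hl1
  obtain ⟨k, -, hk⟩ := Finset.exists_ne_zero_of_sum_ne_zero hl1
  have h1 : i ≤ k := not_lt.1 fun h => left_ne_zero_of_mul hk (hT h)
  have h2 := hJ k l (right_ne_zero_of_mul hk)
  have h3 : l ≤ j := not_lt.1 fun h => right_ne_zero_of_mul hl (hS h)
  linarith [hw h1, hw h3]

theorem RaisesWeight.exists_unitary {w : Fin n → ℝ} {J : Matrix (Fin n) (Fin n) ℂ}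
    (hJ : RaisesWeight w J) (P : GL (Fin n) ℂ) :
    ∃ U ∈ Matrix.unitaryGroup (Fin n) ℂ, ∃ σ : Equiv.Perm (Fin n), ∃ B, RaisesWeight (w ∘ σ) B ∧
      (P : Matrix (Fin n) (Fin n) ℂ) * J * ((P⁻¹ : GL (Fin n) ℂ) : Matrix _ _ ℂ) = U * B * Uᴴ := by
  -- Sorting `-w` increasingly puts the weights in decreasing order, as triangular factors require.
  let σ := Tuple.sort fun i => -w i
  have hσ : Antitone (w ∘ σ) := fun i j hij =>
    neg_le_neg_iff.1 (Tuple.monotone_sort (fun i => -w i) hij)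
  have hJ' : RaisesWeight (w ∘ σ) (J.submatrix σ σ) := fun i j h => hJ _ _ h
  set P₁ := (P : Matrix (Fin n) (Fin n) ℂ).submatrix id σ with hP₁
  set P₂ := ((P⁻¹ : GL (Fin n) ℂ) : Matrix (Fin n) (Fin n) ℂ).submatrix σ id with hP₂
  have hconj : (P : Matrix (Fin n) (Fin n) ℂ) * J * ((P⁻¹ : GL (Fin n) ℂ) : Matrix _ _ ℂ) =
      P₁ * J.submatrix σ σ * P₂ := by
    rw [hP₁, hP₂, Matrix.submatrix_mul_equiv, Matrix.submatrix_mul_equiv, Matrix.submatrix_id_id]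
  have hinv : P₁ * P₂ = 1 := by
    rw [hP₁, hP₂, Matrix.submatrix_mul_equiv, Matrix.submatrix_id_id]
    exact P.mul_inv
  obtain ⟨U, hU, hT⟩ := exists_unitary_isUpperTriangular P₁
  have hU1 : U * Uᴴ = 1 := Matrix.mem_unitaryGroup_iff.1 hU
  have hU2 : Uᴴ * U = 1 := Matrix.mem_unitaryGroup_iff'.1 hU
  have h1 : (Uᴴ * P₁) * (P₂ * U) = 1 := by
    calc (Uᴴ * P₁) * (P₂ * U) = Uᴴ * (P₁ * P₂) * U := by simp only [Matrix.mul_assoc]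
      _ = 1 := by rw [hinv, Matrix.mul_one, hU2]
  let _ : Invertible (Uᴴ * P₁) := invertibleOfRightInverse _ _ h1
  have h2 : (P₂ * U).IsUpperTriangular := by
    rw [← Matrix.inv_eq_right_inv h1]
    exact Matrix.blockTriangular_inv_of_blockTriangular hT
  refine ⟨U, hU, σ, (Uᴴ * P₁) * J.submatrix σ σ * (P₂ * U),
    hJ'.conj_isUpperTriangular hσ hT h2, ?_⟩
  calc _ = P₁ * J.submatrix σ σ * P₂ := hconj
    _ = (U * Uᴴ) * (P₁ * J.submatrix σ σ * P₂) * (U * Uᴴ) := by rw [hU1]; simp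
    _ = _ := by simp only [Matrix.mul_assoc]

/-- A nilpotent operator is strictly triangular in some orthonormal basis. -/
theorem exists_orthonormalBasis_strictly_triangular (n : ℕ) :
    ∀ (E : Type) [NormedAddCommGroup E] [InnerProductSpace ℂ E] [FiniteDimensional ℂ E],
      Module.finrank ℂ E = n → ∀ T : E →ₗ[ℂ] E, IsNilpotent T →
      ∃ b : OrthonormalBasis (Fin n) ℂ E, ∀ i j, inner ℂ (b i) (T (b j)) ≠ 0 → j < i := by
  induction n with
  | zero =>
    intro E _ _ _ hE T hT
    exact ⟨(stdOrthonormalBasis ℂ E).reindex (finCongr hE), fun i => i.elim0⟩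
  | succ n ih =>
    intro E _ _ _ hE T hT
    have : Nontrivial E := Module.nontrivial_of_finrank_eq_succ hE
    -- The first basis vector is a unit vector orthogonal to the range, which is proper by
    -- nilpotency. Its orthogonal complement then contains the range, so `T` restricts to it and the
    -- induction continues there.
    have hr : LinearMap.range T ≠ ⊤ := by
      intro h
      obtain ⟨k, hk⟩ := hT
      have : LinearMap.range (T ^ k) = ⊤ := by
        rw [LinearMap.range_eq_top] at h ⊢
        rw [Module.End.coe_pow]
        exact h.iterate k
      rw [hk, LinearMap.range_zero] at this
      exact bot_ne_top this
    obtain ⟨v₀, hv₀, hv₀'⟩ := Submodule.exists_mem_ne_zero_of_ne_bot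
      (fun h => hr (Submodule.orthogonal_eq_bot_iff.1 h) : (LinearMap.range T)ᗮ ≠ ⊥)
    set v : E := ((‖v₀‖⁻¹ : ℝ) : ℂ) • v₀ with hv
    have hv1 : ‖v‖ = 1 := by
      rw [hv, norm_smul, Complex.norm_real, norm_inv, norm_norm,
        inv_mul_cancel₀ (norm_ne_zero_iff.2 hv₀')]
    have hvT : ∀ x, inner ℂ v (T x) = 0 := by
      intro x
      rw [hv, inner_smul_left, (Submodule.mem_orthogonal' _ _).1 hv₀ _ ⟨x, rfl⟩, mul_zero]
    let W : Submodule ℂ E := (ℂ ∙ v)ᗮ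
    have hW : Module.finrank ℂ W = n := by
      have : Fact (Module.finrank ℂ E = n + 1) := ⟨hE⟩
      exact Submodule.finrank_orthogonal_span_singleton (by rw [← norm_ne_zero_iff, hv1]; exact one_ne_zero)
    have hmap : ∀ x, T x ∈ W := fun x => Submodule.mem_orthogonal_singleton_iff_inner_right.2 (hvT x)
    let T' : W →ₗ[ℂ] W := T.restrict fun x _ => hmap x
    have hT' : IsNilpotent T' := by
      obtain ⟨k, hk⟩ := hT
      refine ⟨k, ?_⟩
      ext x
      rw [Module.End.pow_restrict]
      exact congrArg (fun f : E →ₗ[ℂ] E => f x) hk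
    obtain ⟨b', hb'⟩ := ih W hW T' hT'
    have hon : Orthonormal ℂ (Fin.cons v fun i => (b' i : E) : Fin (n + 1) → E) := by
      have hb := b'.orthonormal
      rw [orthonormal_iff_ite] at hb ⊢
      have hvb : ∀ i, inner ℂ v (b' i : E) = 0 := fun i =>
        Submodule.mem_orthogonal_singleton_iff_inner_right.1 (b' i).2
      intro i j
      refine Fin.cases ?_ (fun i => ?_) i <;> refine Fin.cases ?_ (fun j => ?_) j
      · simp [inner_self_eq_norm_sq_to_K, hv1]
      · simpa [Fin.succ_ne_zero, eq_comm] using hvb j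
      · simpa using inner_eq_zero_symm.1 (hvb i)
      · simpa using hb i j
    let b₀ := basisOfOrthonormalOfCardEqFinrank hon (by simp [hE])
    refine ⟨b₀.toOrthonormalBasis (by
      rw [coe_basisOfOrthonormalOfCardEqFinrank]; exact hon), ?_⟩
    rw [Module.Basis.coe_toOrthonormalBasis, coe_basisOfOrthonormalOfCardEqFinrank]
    intro i j
    refine Fin.cases ?_ (fun i => ?_) i <;> refine Fin.cases ?_ (fun j => ?_) j
    · intro h; exact absurd (hvT _) h
    · intro h; exact absurd (hvT _) h
    · intro _; exact Fin.succ_pos i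
    · intro h
      exact Fin.succ_lt_succ_iff.2 (hb' i j h)

theorem toEuclideanLin_mul (A B : Matrix (Fin n) (Fin n) ℂ) :
    Matrix.toEuclideanLin (A * B) = Matrix.toEuclideanLin A * Matrix.toEuclideanLin B := by
  ext v : 1
  simp

theorem toEuclideanLin_pow (A : Matrix (Fin n) (Fin n) ℂ) (k : ℕ) :
    Matrix.toEuclideanLin (A ^ k) = Matrix.toEuclideanLin A ^ k := by
  induction k with
  | zero =>
    ext v : 1
    simp
  | succ k ih => rw [pow_succ, pow_succ, toEuclideanLin_mul, ih]

theorem isNilpotent_toEuclideanLin {A : Matrix (Fin n) (Fin n) ℂ} (hA : IsNilpotent A) :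
    IsNilpotent (Matrix.toEuclideanLin A) := by
  obtain ⟨k, hk⟩ := hA
  exact ⟨k, by rw [← toEuclideanLin_pow, hk, map_zero]⟩

theorem exists_unitary_raisesWeight_of_isNilpotent {A : Matrix (Fin n) (Fin n) ℂ}
    (hA : IsNilpotent A) : ∃ U ∈ Matrix.unitaryGroup (Fin n) ℂ, ∃ B,
      RaisesWeight (fun a : Fin n => 2 * (a : ℝ) + 1 - n) B ∧ A = U * B * Uᴴ := by
  obtain ⟨b, hb⟩ := exists_orthonormalBasis_strictly_triangular n (EuclideanSpace ℂ (Fin n))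
    (by simp) _ (isNilpotent_toEuclideanLin hA)
  have hU := columnMatrix_mem b
  have hU1 : columnMatrix b * (columnMatrix b)ᴴ = 1 := Matrix.mem_unitaryGroup_iff.1 hU
  refine ⟨_, hU, (columnMatrix b)ᴴ * A * columnMatrix b, fun i j hij => ?_, ?_⟩
  · rw [columnMatrix_conj_apply] at hij
    have : (j : ℝ) + 1 ≤ i := by exact_mod_cast hb i j hij
    linarith
  · calc A = (columnMatrix b * (columnMatrix b)ᴴ) * A * (columnMatrix b * (columnMatrix b)ᴴ) := by
          rw [hU1, Matrix.one_mul, Matrix.mul_one]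
      _ = _ := by simp only [Matrix.mul_assoc]

end triangular
end NilpotentJordan
namespace NilpotentJordan

/-! ### Unitary representations of sl(2). -/

section sl2

open LinearMap

variable {E : Type*} [NormedAddCommGroup E] [InnerProductSpace ℂ E] [FiniteDimensional ℂ E]

/-- `T` and its adjoint are the raising and lowering operators of a unitary representation
of `sl(2)`: this is the relation `[[T, T*], T] = 2 T`. -/
def IsRaising (T : E →ₗ[ℂ] E) : Prop :=
  ∀ x, T.adjoint (T (T x)) + T (T (T.adjoint x)) + (2 : ℂ) • T x = (2 : ℂ) • T (T.adjoint (T x))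

variable {T : E →ₗ[ℂ] E} (hT : IsRaising T)
include hT

theorem IsRaising.adjoint_relation (x : E) :
    T.adjoint (T.adjoint (T x)) + T (T.adjoint (T.adjoint x)) + (2 : ℂ) • T.adjoint x =
      (2 : ℂ) • T.adjoint (T (T.adjoint x)) := by
  refine ext_inner_left ℂ fun y => ?_
  have h := congrArg (fun z => inner ℂ z x) (hT y)
  simp only [inner_add_left, inner_smul_left, Complex.conj_ofNat, adjoint_inner_left] at h
  have h1 : inner ℂ y (T (T.adjoint (T.adjoint x))) = inner ℂ (T (T (T.adjoint y))) x := by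
    rw [← adjoint_inner_left, adjoint_inner_right, adjoint_inner_right]
  have h2 : inner ℂ (T y) (T (T.adjoint x)) = inner ℂ (T (T.adjoint (T y))) x := by
    rw [← adjoint_inner_left, adjoint_inner_right]
  simp only [inner_add_right, inner_smul_right, adjoint_inner_right]
  rw [h1, h2, h]

/-- Thus `T* T` preserves the space of lowest weight vectors, where it can be diagonalized
orthonormally. -/
theorem IsRaising.mem_ker (x : E) (hx : T.adjoint x = 0) :
    T.adjoint (T.adjoint (T x)) = 0 := by
  simpa [hx] using hT.adjoint_relation x

/-- The defining relation expresses `T* T²` through `T T* T`, `T² T*` and `T`, giving a two-term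
recursion along the string `v, T v, T² v, …`; hence the two-step induction. -/
theorem IsRaising.adjoint_pow_succ {m : ℝ} {v : E} (hv : T.adjoint v = 0)
    (hm : T.adjoint (T v) = (m : ℂ) • v) (p : ℕ) :
    T.adjoint ((T ^ (p + 1)) v) = ((((p : ℝ) + 1) * (m - p) : ℝ) : ℂ) • (T ^ p) v := by
  induction p using Nat.twoStepInduction with
  | zero => simp [hm]
  | one =>
    have h := hT v
    rw [hv, hm, map_zero, map_zero, add_zero, map_smul, ← eq_sub_iff_add_eq] at h
    rw [pow_succ', pow_one, Module.End.mul_apply, h]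
    push_cast
    module
  | more p ih1 ih2 =>
    have hpow : ∀ k, T ((T ^ k) v) = (T ^ (k + 1)) v := fun k => by rw [pow_succ']; rfl
    have h := hT ((T ^ (p + 1)) v)
    rw [hpow, hpow, ih1, ih2, map_smul, map_smul, map_smul, hpow, hpow, add_assoc,
      ← eq_sub_iff_add_eq] at h
    rw [h]
    push_cast
    module

theorem IsRaising.norm_pow_succ {m : ℝ} {v : E} (hv : T.adjoint v = 0)
    (hm : T.adjoint (T v) = (m : ℂ) • v) (p : ℕ) :
    ‖(T ^ (p + 1)) v‖ ^ 2 = ((p : ℝ) + 1) * (m - p) * ‖(T ^ p) v‖ ^ 2 := by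
  have h : inner ℂ ((T ^ (p + 1)) v) ((T ^ (p + 1)) v) =
      ((((p : ℝ) + 1) * (m - p) : ℝ) : ℂ) * inner ℂ ((T ^ p) v) ((T ^ p) v) := by
    rw [← inner_smul_right, ← hT.adjoint_pow_succ hv hm, adjoint_inner_right, pow_succ']
    rfl
  have h' := congrArg Complex.re h
  rw [Complex.re_ofReal_mul] at h'
  rw [← inner_self_eq_norm_sq (𝕜 := ℂ), ← inner_self_eq_norm_sq (𝕜 := ℂ)]
  exact h'

/-- Moving one `T` across the inner product lowers both exponents by one, until one string has
reached its bottom, killed by the adjoint. -/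
theorem IsRaising.inner_pow_pow {m : ℝ} {v v' : E} (hv : T.adjoint v = 0) (hv' : T.adjoint v' = 0)
    (hm : T.adjoint (T v') = (m : ℂ) • v') (p q : ℕ) (h : p ≠ q ∨ inner ℂ v v' = 0) :
    inner ℂ ((T ^ p) v) ((T ^ q) v') = 0 := by
  induction p generalizing q with
  | zero =>
    rcases q with _ | q
    · simpa using h
    · rw [pow_zero, Module.End.one_apply, pow_succ', Module.End.mul_apply, ← adjoint_inner_left, hv,
        inner_zero_left]
  | succ p ih =>
    rw [pow_succ', Module.End.mul_apply, ← adjoint_inner_right]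
    rcases q with _ | q
    · rw [pow_zero, Module.End.one_apply, hv', inner_zero_right]
    · rw [hT.adjoint_pow_succ hv' hm, inner_smul_right, ih q (by simpa using h), mul_zero]

theorem IsRaising.exists_lowest_weight_basis :
    ∃ (d : ℕ) (w : OrthonormalBasis (Fin d) ℂ (ker T.adjoint)) (m : Fin d → ℝ),
      ∀ j, T.adjoint (T (w j : E)) = (m j : ℂ) • (w j : E) := by
  have hsym := (isSymmetric_adjoint_mul_self T).restrict_invariant
    (V := ker T.adjoint) fun x hx => hT.mem_ker x hx
  refine ⟨_, hsym.eigenvectorBasis rfl, hsym.eigenvalues rfl, fun j => ?_⟩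
  exact congrArg Subtype.val (hsym.apply_eigenvectorBasis rfl j)

theorem IsRaising.exists_highest_weight (hnil : IsNilpotent T) {m : ℝ} {v : E} (hv0 : v ≠ 0)
    (hv : T.adjoint v = 0) (hm : T.adjoint (T v) = (m : ℂ) • v) :
    ∃ k : ℕ, 0 < k ∧ (∀ p, (T ^ p) v ≠ 0 ↔ p < k) ∧ m = k - 1 := by
  classical
  have hex : ∃ p, (T ^ p) v = 0 := by
    obtain ⟨p, hp⟩ := hnil
    exact ⟨p, by rw [hp]; rfl⟩
  have h0 : 0 < Nat.find hex := by
    rw [Nat.pos_iff_ne_zero]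
    intro h
    have := Nat.find_spec hex
    rw [h] at this
    exact hv0 this
  refine ⟨Nat.find hex, h0, fun p => ⟨fun hp => ?_, fun hp => Nat.find_min hex hp⟩, ?_⟩
  · by_contra! h
    obtain ⟨c, rfl⟩ := Nat.exists_eq_add_of_le' h
    rw [pow_add, Module.End.mul_apply, Nat.find_spec hex, map_zero] at hp
    exact hp rfl
  · obtain ⟨l, hl⟩ := Nat.exists_eq_add_of_lt h0
    rw [zero_add] at hl
    -- At the last nonzero vector of the string the left side vanishes, which forces `m = l`.
    have h1 := hT.norm_pow_succ hv hm l
    rw [← hl, Nat.find_spec hex, norm_zero] at h1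
    have h2 : (T ^ l) v ≠ 0 := Nat.find_min hex (by lia)
    have h3 : (m - l) = 0 := by
      rcases mul_eq_zero.1 (h1.symm.trans (by norm_num)) with h | h
      · exact (mul_eq_zero.1 h).resolve_left (by positivity)
      · exact absurd (pow_eq_zero_iff two_ne_zero |>.1 h) (norm_ne_zero_iff.2 h2)
    rw [hl]
    push_cast
    linarith

/-- A unitary representation of `sl(2)` is an orthogonal sum of standard irreducible ones. -/
theorem IsRaising.exists_orthonormalBasis (hnil : IsNilpotent T) :
    ∃ (d : ℕ) (k : Fin d → ℕ) (b : OrthonormalBasis (Σ j, Fin (k j)) ℂ E), (∀ j, 0 < k j) ∧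
      ∀ x y, inner ℂ (b x) (T (b y)) =
        Matrix.blockDiagonal' (fun j => elementaryBlock (k j)) x y := by
  obtain ⟨d, w, m, hm⟩ := hT.exists_lowest_weight_basis
  have hw : ∀ j, T.adjoint (w j : E) = 0 := fun j => (w j).2
  have hw1 : ∀ j, ‖(w j : E)‖ = 1 := fun j => w.orthonormal.1 j
  have hworth : ∀ i j, i ≠ j → inner ℂ (w i : E) (w j : E) = 0 := fun i j h => w.orthonormal.2 h
  have hw0 : ∀ j, (w j : E) ≠ 0 := fun j => by
    rw [← norm_ne_zero_iff, hw1]; exact one_ne_zero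
  choose k hk0 hk hmk using fun j => hT.exists_highest_weight hnil (hw0 j) (hw j) (hm j)
  -- The normalized strings through an orthonormal eigenbasis of `T* T` on the kernel of the
  -- adjoint.
  let u : (Σ j, Fin (k j)) → E := fun x =>
    ((‖(T ^ (x.2 : ℕ)) (w x.1 : E)‖⁻¹ : ℝ) : ℂ) • (T ^ (x.2 : ℕ)) (w x.1 : E)
  have hne : ∀ j (a : Fin (k j)), ‖(T ^ (a : ℕ)) (w j : E)‖ ≠ 0 := fun j a =>
    norm_ne_zero_iff.2 ((hk j a).2 a.2)
  have hu : Orthonormal ℂ u := by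
    refine ⟨fun x => ?_, fun x y hxy => ?_⟩
    · rw [norm_smul, Complex.norm_real, norm_inv, norm_norm, inv_mul_cancel₀ (hne _ _)]
    · simp only [u]
      rw [inner_smul_left, inner_smul_right, hT.inner_pow_pow (hw _) (hw _) (hm _), mul_zero,
        mul_zero]
      by_contra! h
      obtain ⟨i, a⟩ := x
      obtain ⟨j, c⟩ := y
      by_cases hij : i = j
      · subst hij
        exact hxy (congrArg _ (Fin.ext h.1))
      · exact h.2 (hworth i j hij)
  have hmem : ∀ j p, (T ^ p) (w j : E) ∈ Submodule.span ℂ (Set.range u) := by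
    intro j p
    by_cases hp : p < k j
    · have h : (T ^ p) (w j : E) = ((‖(T ^ p) (w j : E)‖ : ℝ) : ℂ) • u ⟨j, p, hp⟩ := by
        rw [smul_smul, ← Complex.ofReal_mul, mul_inv_cancel₀ (hne j ⟨p, hp⟩), Complex.ofReal_one,
          one_smul]
      rw [h]
      exact Submodule.smul_mem _ _ (Submodule.subset_span ⟨_, rfl⟩)
    · rw [not_not.1 fun h => hp ((hk j p).1 h)]
      exact Submodule.zero_mem _
  have hTspan : ∀ x ∈ Submodule.span ℂ (Set.range u), T x ∈ Submodule.span ℂ (Set.range u) := by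
    intro x hx
    induction hx using Submodule.span_induction with
    | mem x hx =>
      obtain ⟨⟨j, a⟩, rfl⟩ := hx
      rw [map_smul, ← Module.End.mul_apply, ← pow_succ']
      exact Submodule.smul_mem _ _ (hmem _ _)
    | zero => rw [map_zero]; exact Submodule.zero_mem _
    | add x y _ _ hx hy => rw [map_add]; exact Submodule.add_mem _ hx hy
    | smul c x _ hx => rw [map_smul]; exact Submodule.smul_mem _ _ hx
  have hSorth : ∀ x ∈ (Submodule.span ℂ (Set.range u))ᗮ,
      T.adjoint x ∈ (Submodule.span ℂ (Set.range u))ᗮ := by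
    intro x hx z hz
    rw [adjoint_inner_right]
    exact hx _ (hTspan z hz)
  have hker : ∀ x ∈ (Submodule.span ℂ (Set.range u))ᗮ, T.adjoint x = 0 → x = 0 := by
    intro x hx hx0
    have h := w.sum_repr' ⟨x, hx0⟩
    have h2 : x = ∑ j, inner ℂ (w j : E) x • (w j : E) := by
      have h3 := congrArg Subtype.val h
      rw [Submodule.coe_sum] at h3
      exact h3.symm
    rw [h2]
    refine Finset.sum_eq_zero fun j _ => ?_
    have h3 : inner ℂ (w j : E) x = 0 := hx _ (hmem j 0)
    rw [h3, zero_smul]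
  -- The orthogonal complement of the strings is stable under the nilpotent adjoint but meets its
  -- kernel only in zero, since that kernel is spanned by the string bottoms. Hence it is zero.
  have hspan : ⊤ ≤ Submodule.span ℂ (Set.range u) := by
    rw [top_le_iff, ← Submodule.orthogonal_eq_bot_iff, eq_bot_iff]
    intro x hx
    obtain ⟨N, hN⟩ := hnil
    have hpow : ∀ p, ∀ x ∈ (Submodule.span ℂ (Set.range u))ᗮ, (T.adjoint ^ p) x = 0 → x = 0 := by
      intro p
      induction p with
      | zero => exact fun x _ h => h
      | succ p ih =>
        intro x hx h
        rw [pow_succ, Module.End.mul_apply] at h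
        exact hker x hx (ih _ (hSorth x hx) h)
    refine hpow N x hx ?_
    rw [← star_eq_adjoint, ← star_pow, hN, star_zero]
    rfl
  refine ⟨d, k, OrthonormalBasis.mk hu hspan, hk0, ?_⟩
  rintro ⟨i, a⟩ ⟨j, c⟩
  rw [OrthonormalBasis.coe_mk, map_smul, ← Module.End.mul_apply, ← pow_succ', inner_smul_left,
    inner_smul_right]
  by_cases hij : i = j
  · subst hij
    rw [Matrix.blockDiagonal'_apply_eq, elementaryBlock, subdiagonal, Matrix.of_apply]
    split_ifs with hac
    · rw [← hac, inner_self_eq_norm_sq_to_K, Complex.conj_ofReal]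
      have h1 := hT.norm_pow_succ (hw i) (hm i) c
      rw [← hac, hmk] at h1
      -- The matrix entry is the ratio of consecutive norms in the string; the norm recursion with
      -- `m = k i - 1` evaluates it.
      have h2 : √((a : ℝ) * ((k i : ℝ) - a)) = ‖(T ^ (a : ℕ)) (w i : E)‖ /
          ‖(T ^ (c : ℕ)) (w i : E)‖ := by
        rw [Real.sqrt_eq_iff_mul_self_eq_of_pos (by have := hne i a; have := hne i c; positivity)]
        have h3 := hne i c
        have h4 : (a : ℝ) = c + 1 := by exact_mod_cast hac
        rw [div_mul_div_comm, div_eq_iff (by positivity), ← sq, ← sq, h1, h4]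
        ring
      rw [h2]
      have h3 : (‖(T ^ (c : ℕ)) (w i : E)‖ : ℂ) ≠ 0 := by exact_mod_cast hne i c
      have h4 : (‖(T ^ (a : ℕ)) (w i : E)‖ : ℂ) ≠ 0 := by exact_mod_cast hne i a
      push_cast
      simp only [Complex.coe_algebraMap]
      field_simp
    · rw [hT.inner_pow_pow (hw _) (hw _) (hm _) _ _ (Or.inl hac), mul_zero, mul_zero]
  · rw [Matrix.blockDiagonal'_apply_ne _ _ _ hij,
      hT.inner_pow_pow (hw _) (hw _) (hm _) _ _ (Or.inr (hworth i j hij)), mul_zero, mul_zero]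

end sl2

end NilpotentJordan
namespace NilpotentJordan

/-! ### From the sl(2)-decomposition to conjugacy under SU(n), and the Jordan type. -/

section reindex

theorem exists_equiv_of_card_fiber_eq {α β : Type*} [Fintype α] [Fintype β] (f : α → ℕ) (g : β → ℕ)
    (h : ∀ c, (∑ a, if f a = c then 1 else 0) = ∑ b, if g b = c then 1 else 0) :
    ∃ e : α ≃ β, ∀ a, g (e a) = f a := by
  have h1 : ∀ c, Nonempty ({a // f a = c} ≃ {b // g b = c}) := fun c => by
    rw [← Fintype.card_eq, Fintype.card_subtype, Fintype.card_subtype, Finset.card_filter,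
      Finset.card_filter, h]
  exact ⟨Equiv.ofFiberEquiv fun c => (h1 c).some, Equiv.ofFiberEquiv_map _⟩

theorem blockDiagonal'_reindex {d d' : ℕ} {k : Fin d → ℕ} {k' : Fin d' → ℕ} (f : Fin d ≃ Fin d')
    (hf : ∀ p, k' (f p) = k p) (B : (i : ℕ) → Matrix (Fin i) (Fin i) ℂ)
    (x y : Σ p, Fin (k p)) :
    Matrix.blockDiagonal' (fun j => B (k' j))
        (Equiv.sigmaCongr f (fun p => finCongr (hf p).symm) x)
        (Equiv.sigmaCongr f (fun p => finCongr (hf p).symm) y) =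
      Matrix.blockDiagonal' (fun p => B (k p)) x y := by
  have hB : ∀ {i i' : ℕ} (h : i = i') (a b : Fin i), B i' (Fin.cast h a) (Fin.cast h b) = B i a b := by
    rintro i _ rfl a b
    rfl
  obtain ⟨p, a⟩ := x
  obtain ⟨q, b⟩ := y
  by_cases hpq : p = q
  · subst hpq
    rw [Matrix.blockDiagonal'_apply_eq]
    exact (Matrix.blockDiagonal'_apply_eq _ _ _ _).trans (hB (hf p).symm a b)
  · rw [Matrix.blockDiagonal'_apply_ne _ _ _ hpq]
    exact Matrix.blockDiagonal'_apply_ne _ _ _ fun h => hpq (f.injective h)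

end reindex

variable {n : ℕ}

theorem isRaising_toEuclideanLin {B : Matrix (Fin n) (Fin n) ℂ} (hB : ⁅⁅B, Bᴴ⁆, B⁆ = (2 : ℂ) • B) :
    IsRaising (Matrix.toEuclideanLin B) := by
  have h : Bᴴ * B * B + B * B * Bᴴ + (2 : ℂ) • B = (2 : ℂ) • (B * Bᴴ * B) := by
    rw [← hB, Ring.lie_def, Ring.lie_def, Matrix.sub_mul, Matrix.mul_sub, two_smul,
      ← Matrix.mul_assoc, ← Matrix.mul_assoc]
    abel
  have h2 := congrArg Matrix.toEuclideanLin h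
  simp only [map_add, map_smul, toEuclideanLin_mul,
    Matrix.toEuclideanLin_conjTranspose_eq_adjoint] at h2
  exact fun x => congrArg (fun f : EuclideanSpace ℂ (Fin n) →ₗ[ℂ] _ => f x) h2

theorem exists_unitary_stdNilpotent {B : Matrix (Fin n) (Fin n) ℂ} (hnil : IsNilpotent B)
    (hB : ⁅⁅B, Bᴴ⁆, B⁆ = (2 : ℂ) • B) :
    ∃ nu : n.Partition, ∃ U ∈ Matrix.unitaryGroup (Fin n) ℂ, B = U * stdNilpotent nu * Uᴴ := by
  obtain ⟨d, k, b, hk, hb⟩ := (isRaising_toEuclideanLin hB).exists_orthonormalBasis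
    (isNilpotent_toEuclideanLin hnil)
  have hsum : ∑ j, k j = n := by
    have h := Module.finrank_eq_card_basis b.toBasis
    simpa using h.symm
  let nu : n.Partition :=
    { parts := Finset.univ.val.map k
      parts_pos := fun {i} hi => by
        obtain ⟨j, -, rfl⟩ := Multiset.mem_map.1 hi
        exact hk j
      parts_sum := hsum }
  -- The strings come in arbitrary order; matching multiplicities of lengths sorts them into the
  -- order of the parts of `nu`.
  obtain ⟨f, hf⟩ := exists_equiv_of_card_fiber_eq (sortedParts nu).blocksFun k fun c => by
    rw [sum_blocksFun_eq nu fun i => if i = c then 1 else 0]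
    change ((Finset.univ.val.map k).map _).sum = _
    rw [Multiset.map_map]
    rfl
  let e : (Σ p, Fin ((sortedParts nu).blocksFun p)) ≃ Σ j, Fin (k j) :=
    Equiv.sigmaCongr f fun p => finCongr (hf p).symm
  let b' := b.reindex (e.symm.trans (sortedParts nu).blocksFinEquiv)
  have hU := columnMatrix_mem b'
  have hU1 : columnMatrix b' * (columnMatrix b')ᴴ = 1 := Matrix.mem_unitaryGroup_iff.1 hU
  refine ⟨nu, columnMatrix b', hU, ?_⟩
  have h : (columnMatrix b')ᴴ * B * columnMatrix b' = stdNilpotent nu := by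
    ext x y
    obtain ⟨x, rfl⟩ := (sortedParts nu).blocksFinEquiv.surjective x
    obtain ⟨y, rfl⟩ := (sortedParts nu).blocksFinEquiv.surjective y
    rw [columnMatrix_conj_apply, stdNilpotent, blockMatrix_apply, ← blockDiagonal'_reindex f hf,
      ← hb]
    simp only [b', OrthonormalBasis.reindex_apply, Equiv.symm_trans_apply, Equiv.symm_symm,
      Equiv.symm_apply_apply]
    rfl
  calc B = (columnMatrix b' * (columnMatrix b')ᴴ) * B * (columnMatrix b' * (columnMatrix b')ᴴ) := by
        rw [hU1, Matrix.one_mul, Matrix.mul_one]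
    _ = columnMatrix b' * ((columnMatrix b')ᴴ * B * columnMatrix b') * (columnMatrix b')ᴴ := by
        simp only [Matrix.mul_assoc]
    _ = _ := by rw [h]

theorem suConjugate_of_unitary {A B U : Matrix (Fin n) (Fin n) ℂ}
    (hU : U ∈ Matrix.unitaryGroup (Fin n) ℂ) (h : A = U * B * Uᴴ) : SUConjugate A B := by
  rcases Nat.eq_zero_or_pos n with rfl | hn
  · exact ⟨1, Matrix.ext fun i => i.elim0⟩
  have hdet : ‖U.det‖ = 1 := CStarRing.norm_of_mem_unitary (Matrix.det_of_mem_unitary hU)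
  -- An `n`-th root of the inverse determinant has modulus 1; scaling `U` by it makes the
  -- determinant 1 without changing the conjugation.
  obtain ⟨z, hz⟩ := IsAlgClosed.exists_pow_nat_eq (U.det)⁻¹ hn
  have hz1 : ‖z‖ = 1 := by
    have h1 := congrArg norm hz
    rw [norm_pow, norm_inv, hdet, inv_one] at h1
    exact (pow_eq_one_iff_of_nonneg (norm_nonneg z) hn.ne').1 h1
  have hzz : z * star z = 1 := by
    rw [Complex.star_def, Complex.mul_conj', hz1]
    norm_num
  have hmem : z • U ∈ Matrix.specialUnitaryGroup (Fin n) ℂ := by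
    rw [Matrix.mem_specialUnitaryGroup_iff]
    refine ⟨?_, ?_⟩
    · rw [Matrix.mem_unitaryGroup_iff, star_smul, smul_mul_smul_comm, hzz, one_smul]
      exact Matrix.mem_unitaryGroup_iff.1 hU
    · rw [Matrix.det_smul, Fintype.card_fin, hz, inv_mul_cancel₀]
      rw [← norm_ne_zero_iff, hdet]
      exact one_ne_zero
  refine ⟨⟨z • U, hmem⟩, ?_⟩
  change A = (z • U) * B * (z • U)ᴴ
  rw [Matrix.conjTranspose_smul, Matrix.smul_mul, smul_mul_smul_comm, hzz, one_smul, h]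

theorem K_eq_of_suConjugate {A B : Matrix (Fin n) (Fin n) ℂ} {c : ℂ} (hc : c ≠ 0)
    (h : SUConjugate A (c • B)) : K A = K B := by
  obtain ⟨U, hU⟩ := h
  have hmem : (U : Matrix (Fin n) (Fin n) ℂ) ∈ Matrix.unitaryGroup (Fin n) ℂ :=
    (Matrix.mem_specialUnitaryGroup_iff.1 U.2).1
  rw [hU, K_conj hmem, K_smul hc]

/-- The bound obtained from a grading, and the shape of the matrices attaining it. -/
theorem RaisesWeight.le_K_and_eq {A U B : Matrix (Fin n) (Fin n) ℂ} {w : Fin n → ℝ}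
    (hU : U ∈ Matrix.unitaryGroup (Fin n) ℂ) (hB : RaisesWeight w B) (hA : A = U * B * Uᴴ)
    (hA0 : A ≠ 0) (hnil : IsNilpotent A) :
    0 < ∑ i, w i ^ 2 ∧ 4 / ∑ i, w i ^ 2 ≤ K A ∧ (K A = 4 / ∑ i, w i ^ 2 →
      ∃ nu : n.Partition, ∃ c : ℂ, c ≠ 0 ∧ SUConjugate A (c • stdNilpotent nu)) := by
  have hB0 : B ≠ 0 := by
    rintro rfl
    exact hA0 (by rw [hA]; simp)
  have hK : K A = K B := by rw [hA, K_conj hU]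
  refine ⟨hB.sum_sq_pos hB0, hK ▸ hB.le_K hB0, fun h => ?_⟩
  obtain ⟨c, hc, hcB⟩ := hB.lie_lie_eq hB0 (hK ▸ h)
  have hc0 : (c : ℂ) ≠ 0 := by exact_mod_cast hc.ne'
  have hcA : ⁅⁅A, Aᴴ⁆, A⁆ = ((2 * c ^ 2 : ℝ) : ℂ) • A := by
    rw [hA, conj_conjTranspose, conj_lie hU, conj_lie hU, hcB, Matrix.mul_smul, Matrix.smul_mul]
  -- The double bracket is cubic in the real scalar, so dividing `A` by `c` turns the factor `2 c²`
  -- into 2.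
  obtain ⟨nu, V, hV, hVA⟩ := exists_unitary_stdNilpotent (B := (c : ℂ)⁻¹ • A)
    (hnil.smul _) (by
      have h1 : star (c : ℂ)⁻¹ = (c : ℂ)⁻¹ := by
        rw [Complex.star_def, map_inv₀, Complex.conj_ofReal]
      have h2 : ⁅⁅(c : ℂ)⁻¹ • A, ((c : ℂ)⁻¹ • A)ᴴ⁆, (c : ℂ)⁻¹ • A⁆ =
          ((c : ℂ)⁻¹ * (c : ℂ)⁻¹ * (c : ℂ)⁻¹) • ⁅⁅A, Aᴴ⁆, A⁆ := by
        simp only [Matrix.conjTranspose_smul, h1, Ring.lie_def, smul_mul_smul_comm, ← smul_sub]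
        rw [← mul_assoc, ← smul_sub]
      rw [h2, hcA, smul_smul, smul_smul]
      congr 1
      push_cast
      field_simp)
  refine ⟨nu, c, hc0, suConjugate_of_unitary hV ?_⟩
  rw [Matrix.mul_smul, Matrix.smul_mul, ← hVA, smul_smul, mul_inv_cancel₀ hc0, one_smul]

theorem rank_pow_of_hasJordanType {A : Matrix (Fin n) (Fin n) ℂ} {mu : n.Partition}
    (h : HasJordanType A mu) (q : ℕ) : (A ^ q).rank = (mu.parts.map (· - q)).sum := by
  obtain ⟨P, rfl⟩ := h
  have h1 : ((P : Matrix (Fin n) (Fin n) ℂ) * jordanForm mu *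
      ((P⁻¹ : GL (Fin n) ℂ) : Matrix _ _ ℂ)) ^ q =
      (P : Matrix (Fin n) (Fin n) ℂ) * jordanForm mu ^ q *
        ((P⁻¹ : GL (Fin n) ℂ) : Matrix _ _ ℂ) := Units.conj_pow P _ q
  rw [h1, Matrix.rank_mul_eq_left_of_isUnit_det _ _
    ((Matrix.isUnit_iff_isUnit_det _).1 (P⁻¹).isUnit),
    Matrix.rank_mul_eq_right_of_isUnit_det _ _ ((Matrix.isUnit_iff_isUnit_det _).1 P.isUnit)]
  exact rank_blockMatrix_pow mu (r := fun _ _ => 1) (fun _ _ _ _ => one_ne_zero) q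

theorem rank_pow_of_suConjugate {A : Matrix (Fin n) (Fin n) ℂ} {nu : n.Partition} {c : ℂ}
    (hc : c ≠ 0) (h : SUConjugate A (c • stdNilpotent nu)) (q : ℕ) :
    (A ^ q).rank = (nu.parts.map (· - q)).sum := by
  obtain ⟨U, rfl⟩ := h
  have hmem := (Matrix.mem_specialUnitaryGroup_iff.1 U.2).1
  set P : GL (Fin n) ℂ := ⟨U, (U : Matrix (Fin n) (Fin n) ℂ)ᴴ, Matrix.mem_unitaryGroup_iff.1 hmem,
    Matrix.mem_unitaryGroup_iff'.1 hmem⟩ with hP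
  have h1 : ((U : Matrix (Fin n) (Fin n) ℂ) * (c • stdNilpotent nu) *
      (U : Matrix (Fin n) (Fin n) ℂ)ᴴ) ^ q = (P : Matrix (Fin n) (Fin n) ℂ) *
      (c • stdNilpotent nu) ^ q * ((P⁻¹ : GL (Fin n) ℂ) : Matrix _ _ ℂ) := Units.conj_pow P _ q
  rw [h1, Matrix.rank_mul_eq_left_of_isUnit_det _ _
    ((Matrix.isUnit_iff_isUnit_det _).1 (P⁻¹).isUnit),
    Matrix.rank_mul_eq_right_of_isUnit_det _ _ ((Matrix.isUnit_iff_isUnit_det _).1 P.isUnit)]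
  have h2 : c • stdNilpotent nu = blockMatrix (fun k => subdiagonal k fun p =>
      c * ((Real.sqrt ((p : ℝ) * ((k : ℝ) - (p : ℝ))) : ℝ) : ℂ)) nu := by
    rw [stdNilpotent, smul_blockMatrix]
    congr 1
    ext k a b
    simp only [elementaryBlock, subdiagonal, Matrix.smul_apply, Matrix.of_apply, smul_eq_mul,
      mul_ite, mul_zero]
  rw [h2]
  refine rank_blockMatrix_pow nu (r := fun k p =>
    c * ((Real.sqrt ((p : ℝ) * ((k : ℝ) - (p : ℝ))) : ℝ) : ℂ)) (fun k a h0 hk => ?_) q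
  refine mul_ne_zero hc (Complex.ofReal_ne_zero.2 (Real.sqrt_ne_zero'.2 ?_))
  have h3 : (0 : ℝ) < a := by exact_mod_cast h0
  have h4 : (a : ℝ) < k := by exact_mod_cast hk
  exact mul_pos h3 (by linarith)

theorem HasJordanType.eq_of_suConjugate {A : Matrix (Fin n) (Fin n) ℂ} {mu nu : n.Partition}
    (hmu : HasJordanType A mu) {c : ℂ} (hc : c ≠ 0)
    (h : SUConjugate A (c • stdNilpotent nu)) : nu = mu :=
  partition_eq_of_sum_map_sub_eq fun q => by
    rw [← rank_pow_of_suConjugate hc h, ← rank_pow_of_hasJordanType hmu]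

end NilpotentJordan

/-! ### The two bounds and their equality cases. -/

open NilpotentJordan in
theorem mainTheorem4 (n : ℕ) (A : Matrix (Fin n) (Fin n) ℂ)
    (hA : A ∈ NilpotentJordan.nilpotentCone n) (hA0 : A ≠ 0) :
    (∀ lam : n.Partition, NilpotentJordan.JordanTypeAtMost A lam →
      NilpotentJordan.jordanConst lam =
          12 / (lam.parts.map fun k : ℕ => (k : ℝ) * ((k : ℝ) ^ 2 - 1)).sum ∧
      NilpotentJordan.K A ≥ NilpotentJordan.jordanConst lam ∧
      (NilpotentJordan.K A = NilpotentJordan.jordanConst lam ↔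
        ∃ c : ℂ, c ≠ 0 ∧
          NilpotentJordan.SUConjugate A (c • NilpotentJordan.stdNilpotent lam))) ∧
    NilpotentJordan.jordanConst (Nat.Partition.indiscrete n) =
        12 / ((n : ℝ) * ((n : ℝ) ^ 2 - 1)) ∧
    NilpotentJordan.K A ≥ 12 / ((n : ℝ) * ((n : ℝ) ^ 2 - 1)) ∧
    (NilpotentJordan.K A = 12 / ((n : ℝ) * ((n : ℝ) ^ 2 - 1)) ↔
      ∃ c : ℂ, c ≠ 0 ∧
        NilpotentJordan.SUConjugate A (c • NilpotentJordan.elementaryBlock n)) := by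
  have hn : n ≠ 0 := by
    rintro rfl
    exact hA0 (Matrix.ext fun i => i.elim0)
  have hfour : ∀ s : ℝ, 4 / (s / 3) = 12 / s := fun s => by
    rw [div_div_eq_mul_div]
    norm_num
  refine ⟨fun lam hlam => ⟨jordanConst_eq lam, ?_⟩, ?_⟩
  · obtain ⟨mu, hmu, hdom⟩ := hlam
    obtain ⟨P, hP⟩ := id hmu
    obtain ⟨U, hU, σ, B, hB, hUB⟩ := (raisesWeight_jordanForm mu).exists_unitary P
    obtain ⟨hpos, hle, heq⟩ := hB.le_K_and_eq hU (hP.trans hUB) hA0 hA.2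
    have hsum : ∑ i, (weight mu ∘ σ) i ^ 2 = (mu.parts.map cubic).sum / 3 :=
      (Equiv.sum_comp σ fun i => weight mu i ^ 2).trans (sum_weight_sq mu)
    rw [hsum] at hpos
    rw [hsum, hfour] at hle heq
    have hmono := cubic_sum_le hdom
    have hmupos : 0 < (mu.parts.map cubic).sum := by linarith
    have hle2 : 12 / (lam.parts.map cubic).sum ≤ 12 / (mu.parts.map cubic).sum := by gcongr
    refine ⟨(jordanConst_eq lam).le.trans (hle2.trans hle), fun h => ?_, ?_⟩
    · rw [jordanConst_eq] at h
      -- Equality for `lam` squeezes `K A` between the constants of `lam` and `mu`, so these agree;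
      -- strictness of the convexity inequality gives `mu = lam`.
      have h1 : K A = 12 / (mu.parts.map cubic).sum := le_antisymm (h ▸ hle2) hle
      have h2 : (mu.parts.map cubic).sum = (lam.parts.map cubic).sum := by
        rw [h1, div_eq_div_iff hmupos.ne' (hmupos.trans_le hmono).ne'] at h
        linarith
      obtain rfl := hdom.eq_of_cubic_sum_eq h2
      obtain ⟨nu, c, hc, hnu⟩ := heq h1
      obtain rfl := hmu.eq_of_suConjugate hc hnu
      exact ⟨c, hc, hnu⟩
    · rintro ⟨c, hc, h⟩
      exact K_eq_of_suConjugate hc h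
  · obtain ⟨U, hU, B, hB, hUB⟩ := exists_unitary_raisesWeight_of_isNilpotent hA.2
    obtain ⟨hpos, hle, heq⟩ := hB.le_K_and_eq hU hUB hA0 hA.2
    rw [Fin.sum_weight_sq] at hpos
    rw [Fin.sum_weight_sq, hfour] at hle heq
    have hind : ((Nat.Partition.indiscrete n).parts.map cubic).sum = cubic n := by
      rw [Nat.Partition.indiscrete_parts hn, Multiset.map_singleton, Multiset.sum_singleton]
    refine ⟨by rw [jordanConst_eq, hind]; rfl, hle, fun h => ?_, ?_⟩
    · obtain ⟨nu, c, hc, hnu⟩ := heq h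
      -- No Jordan type is given here: `K A` is the constant of `nu`, and `nu` is dominated by `(n)`
      -- with the same cubic sum, hence equals it.
      have h1 : 12 / (nu.parts.map cubic).sum = 12 / cubic n := by
        rw [← jordanConst_eq, jordanConst, ← K_eq_of_suConjugate hc hnu]
        exact h
      have h2 : (nu.parts.map cubic).sum =
          ((Nat.Partition.indiscrete n).parts.map cubic).sum := by
        rw [hind]
        rw [div_eq_mul_inv, div_eq_mul_inv] at h1
        exact inv_injective (mul_left_cancel₀ (by norm_num) h1)
      obtain rfl := (dominatedBy_indiscrete hn nu).eq_of_cubic_sum_eq h2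
      rw [stdNilpotent_indiscrete hn] at hnu
      exact ⟨c, hc, hnu⟩
    · rintro ⟨c, hc, h⟩
      rw [K_eq_of_suConjugate hc h, K_elementaryBlock]
      rfl
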